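/- All lattices are finite. An element $x$ of a lattice $L$ is reducible if $x=y\vee z$ or $x=y\wedge z$ for some $y,z\in L$ both distinct from $x$. The nullity of a finite poset is $m-n+c$, where $m$, $n$, $c$ are the numbers of edges, vertices and connected components of its cover graph. A block is a lattice whose least and greatest elements are both reducible. A basic block associated to a finite poset $P$ is a subposet obtained from $P$ as follows. First delete successively, as long as possible, elements $x$ that have, in the current subposet, exactly one lower cover $y$ and exactly one upper cover $z$ and for which $y\prec x\prec z$ is the only path of coverings from $y$ up to $z$. Then delete successively, as long as possible, the pendant vertices (vertices of degree one in the cover graph of the current subposet). The height of a finite poset is the number of coverings in a longest chain. For integers $j,r,k,h$ let $\mathscr{B}(j;r,k,h)$ be the set of isomorphism classes of blocks on $j$ elements that have exactly $r$ reducible elements, any two of which are comparable, that have nullity $k$, and whose associated basic block has height $h$. Let $P_n^2$ denote the number of partitions of $n$ into exactly two positive parts. **Theorem.** For every integer $j\ge 10$, $$|\mathscr{B}(j;5,3,6)|=\sum_{u=4}^{j-6}\sum_{r=0}^{u-4}\sum_{l=1}^{j-u-5}\sum_{s=1}^{j-u-l-4}4\,P_{u-r-2}^{2}P^{2}_{j-u-l-s-2}+\sum_{p=7}^{j-3}\sum_{q=1}^{p-6}\sum_{l=2}^{p-q-4}2(l-1)P^{2}_{p-q-l-2}P_{j-p-1}^{2}$$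 $$+\sum_{t=1}^{j-9}\sum_{k=2}^{j-t-7}\sum_{l=4}^{j-k-t-3}(k-1)P_{l-2}^{2}P_{j-k-t-l-1}^{2}+\sum_{s=1}^{j-9}\sum_{t=1}^{j-s-8}\sum_{m=0}^{j-t-s-8}\sum_{p=4}^{j-t-s-m-4}2\,P_{p-2}^{2}P_{j-t-s-m-p-2}^{2}.$$ -/

import Mathlib

open Finset

/-- The number of partitions of `n` into exactly `k` (positive) parts, written `P_n^k`. -/
noncomputable def partitionCount (n k : ℕ) : ℕ :=
  Nat.card {p : Nat.Partition n // p.parts.card = k}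

section Reducible

variable {α : Type*} [Lattice α]

/-- `x` is join-reducible: `y ⊔ z = x` for some `y`, `z` both distinct from `x`. -/
def JoinReducible (x : α) : Prop := ∃ y z : α, y ≠ x ∧ z ≠ x ∧ y ⊔ z = x

/-- `x` is meet-reducible: `y ⊓ z = x` for some `y`, `z` both distinct from `x`. -/
def MeetReducible (x : α) : Prop := ∃ y z : α, y ≠ x ∧ z ≠ x ∧ y ⊓ z = x

/-- `x` is reducible: join-reducible or meet-reducible. -/
def IsReducible (x : α) : Prop := JoinReducible x ∨ MeetReducible x

end Reducible

/-- The set `Red(L)` of reducible elements of a lattice. -/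
def redSet (α : Type*) [Lattice α] : Set α := {x | IsReducible x}

/-- An RC-lattice: any two reducible elements are comparable. -/
def IsRCLattice (α : Type*) [Lattice α] : Prop := IsChain (· ≤ ·) (redSet α)

/-- A block: a lattice whose least element `0` and greatest element `1` exist and are
reducible. -/
def IsBlock (α : Type*) [Lattice α] : Prop :=
  (∃ x : α, IsBot x ∧ IsReducible x) ∧ (∃ x : α, IsTop x ∧ IsReducible x)

/-- The nullity of a finite poset, i.e. the nullity `m - n + c` of its cover graph, where `m`,
`n`, `c` are the numbers of edges, vertices and connected components. -/
noncomputable def nullity (P : Type*) [PartialOrder P] : ℤ :=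
  ((SimpleGraph.hasse P).edgeSet.ncard : ℤ) - (Nat.card P : ℤ)
    + (Nat.card (SimpleGraph.hasse P).ConnectedComponent : ℤ)

section BasicBlock

/-- `x` is a retractible element of the poset `P`: it has exactly one lower cover `y` and exactly
one upper cover `z`, and there is no directed path from `y` to `z` in the cover graph other than
`y ⋖ x ⋖ z`. Equivalently, `y ⋖ z` once `x` is deleted; these are the elements with exactly
one lower and one upper cover whose deletion does not change the nullity. -/
def IsRetractible {P : Type*} [PartialOrder P] (x : P) : Prop :=
  ∃ y z : P, (∀ w : P, w ⋖ x ↔ w = y) ∧ (∀ w : P, x ⋖ w ↔ w = z) ∧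
    ∀ w : P, y < w → w < z → w = x

/-- `x` is a pendant vertex of the poset `P`: it has degree one in the cover graph. -/
def IsPendant {P : Type*} [PartialOrder P] (x : P) : Prop :=
  ∃! y : P, (SimpleGraph.hasse P).Adj x y

variable {P : Type*} [PartialOrder P]

/-- The subposet `T` arises from the subposet `S` by deleting one retractible element of `S`. -/
def RetractStep (S T : Set P) : Prop :=
  ∃ x : S, IsRetractible x ∧ T = S \ {(x : P)}

/-- The subposet `T` arises from the subposet `S` by deleting one pendant vertex of `S`. -/
def PendantStep (S T : Set P) : Prop :=
  ∃ x : S, IsPendant x ∧ T = S \ {(x : P)}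

/-- `R ⊆ P` is a basic retract associated to `P`: it is obtained from `P` by successive removal
of retractible elements until there are none. -/
def IsBasicRetractOf (R : Set P) : Prop :=
  Relation.ReflTransGen RetractStep Set.univ R ∧ ∀ x : R, ¬ IsRetractible x

/-- `B ⊆ P` is a basic block associated to `P`: it is obtained from a basic retract associated
to `P` by successive removal of all the pendant vertices. -/
def IsBasicBlockOf (B : Set P) : Prop :=
  ∃ R : Set P, IsBasicRetractOf R ∧ Relation.ReflTransGen PendantStep R B ∧
    ∀ x : B, ¬ IsPendant x

end BasicBlock

/-- Membership of a finite lattice in the class of blocks that have exactly `r` reducible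
elements, all of them comparable, that have nullity `k`, and whose associated basic block has
height `h` (the number of coverings in a longest chain). -/
structure IsBlockOfType (α : Type*) [Lattice α] (r k h : ℕ) : Prop where
  isBlock : IsBlock α
  isRC : IsRCLattice α
  ncard_red : (redSet α).ncard = r
  nullity_eq : nullity α = (k : ℤ)
  height_eq : ∃ B : Set α, IsBasicBlockOf B ∧ Order.krullDim B = (h : WithBot ℕ∞)

/-- A lattice structure on the set `{0, …, j - 1}`. -/
structure FinLattice (j : ℕ) where
  /-- The lattice structure (unrelated to the usual order of `Fin j`). -/
  str : Lattice (Fin j)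

/-- The underlying set of `L`, without the usual order of `Fin j`. -/
def FinLattice.Carrier {j : ℕ} (_L : FinLattice j) : Type := Fin j

instance FinLattice.instLatticeCarrier {j : ℕ} (L : FinLattice j) : Lattice L.Carrier := L.str

/-- Order isomorphism, as an equivalence relation on the `j`-element lattices of a given type. -/
def blockSetoid (j r k h : ℕ) : Setoid {L : FinLattice j // IsBlockOfType L.Carrier r k h} where
  r L M := Nonempty (L.1.Carrier ≃o M.1.Carrier)
  iseqv :=
    { refl := fun _ => ⟨OrderIso.refl _⟩
      symm := fun ⟨e⟩ => ⟨e.symm⟩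
      trans := fun ⟨e⟩ ⟨f⟩ => ⟨e.trans f⟩ }

/-- The class `𝓑(j; r, k, h)`: isomorphism classes of (maximal) blocks on `j` elements with
exactly `r` reducible elements, all comparable, with nullity `k`, and whose associated basic
block has height `h`. -/
def BlockClass (j r k h : ℕ) : Type := Quotient (blockSetoid j r k h)

/-! In a block whose reducible elements form a chain, incomparable elements have reducible meet and
join. Hence the irreducible elements split into strands, that is, chains of beads, each hanging
between two nodes (reducible elements) of the chain: this is `ReducibleChain.nonempty_orderIso`. An
isomorphism must fix the nodes, so the multiset of triples (lower end, upper end, number of beads)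
is a complete invariant, and `card_blockClass` turns the count of isomorphism classes into a count
of such multisets.

All the data of the type can be read off the multiset. Call a pair of consecutive nodes a gap. A
strand is essential if it skips a node or has a parallel strand; a node is reducible iff it is an
end of an essential strand. The nullity is the number of strands plus the number of empty gaps minus
`n`, the beads cancelling. Retraction leaves exactly one bead on each essential strand and none
elsewhere, no pendant vertex arises, and the height is `n` plus the number of gaps that hold at
least two strands (`Elem.isBlockOfType_iff`).

For five nodes, height six means that exactly two of the four gaps are multiple. Counting an empty
gap as one, the gaps contribute at least 2 + 2 + 1 + 1 = 6 to a total that nullity three fixes at 7.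
Two multiple gaps never touch all five nodes, so the remaining unit must be a strand that skips a
node and ends at the missing ones. This leaves nine shapes (`StrandSystem.exists_isSlotMult`): two
gaps with two strands each, one long strand, and two gaps with at most one strand. In each shape the
sizes are two partitions into two parts, a positive number and two nonnegative numbers. Each of the
four sums, stripped of its constant, is the sum over these sizes, and 4 + 2 + 1 + 2 = 9. -/

/-! ### The lattice of a strand system -/

/-- A chain of `n + 1` nodes together with a finite family of strands, each of which joins a node
to a higher one and carries a positive number of beads. -/
structure StrandSystem (n : ℕ) where
  /-- The index set of the strands. -/
  ι : Type
  [fintype : Fintype ι]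
  /-- The lower end of a strand. -/
  src : ι → Fin (n + 1)
  /-- The upper end of a strand. -/
  tgt : ι → Fin (n + 1)
  /-- The number of beads on a strand. -/
  len : ι → ℕ
  src_lt_tgt : ∀ i, src i < tgt i
  len_pos : ∀ i, 0 < len i

namespace StrandSystem

variable {n : ℕ} (S : StrandSystem n)

instance : Fintype S.ι := S.fintype

grind_pattern src_lt_tgt => self.src i

grind_pattern src_lt_tgt => self.tgt i

/-- The elements of the lattice described by a strand system: its nodes and beads. -/
inductive Elem : Type
  | node (a : Fin (n + 1)) : Elem
  | bead (i : S.ι) (t : ℕ) (h : t < S.len i) : Elem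

variable {S}

namespace Elem

/-- The greatest node below an element. -/
def lo : S.Elem → Fin (n + 1)
  | node a => a
  | bead i _ _ => S.src i

/-- The least node above an element. -/
def hi : S.Elem → Fin (n + 1)
  | node a => a
  | bead i _ _ => S.tgt i

@[simp] lemma lo_node (a : Fin (n + 1)) : (node a : S.Elem).lo = a := rfl

@[simp] lemma hi_node (a : Fin (n + 1)) : (node a : S.Elem).hi = a := rfl

@[simp] lemma lo_bead (i : S.ι) (t : ℕ) (h : t < S.len i) : (bead i t h).lo = S.src i := rfl

@[simp] lemma hi_bead (i : S.ι) (t : ℕ) (h : t < S.len i) : (bead i t h).hi = S.tgt i := rfl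

/-- The order: either a node separates the two elements, or they are beads of one strand. -/
def Le : S.Elem → S.Elem → Prop
  | node a, node b => a ≤ b
  | node a, bead i _ _ => a ≤ S.src i
  | bead i _ _, node b => S.tgt i ≤ b
  | bead i s _, bead k t _ => S.tgt i ≤ S.src k ∨ (i = k ∧ s ≤ t)

instance : LE S.Elem := ⟨Le⟩

@[simp] lemma node_le_node {a b : Fin (n + 1)} : (node a : S.Elem) ≤ node b ↔ a ≤ b := Iff.rfl

@[simp] lemma node_le_bead {a : Fin (n + 1)} {i : S.ι} {t : ℕ} {h : t < S.len i} :
    node a ≤ bead i t h ↔ a ≤ S.src i := Iff.rfl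

@[simp] lemma bead_le_node {a : Fin (n + 1)} {i : S.ι} {t : ℕ} {h : t < S.len i} :
    bead i t h ≤ node a ↔ S.tgt i ≤ a := Iff.rfl

@[simp] lemma bead_le_bead {i k : S.ι} {s t : ℕ} {hs : s < S.len i} {ht : t < S.len k} :
    bead i s hs ≤ bead k t ht ↔ S.tgt i ≤ S.src k ∨ (i = k ∧ s ≤ t) := Iff.rfl

instance : PartialOrder S.Elem where
  le_refl x := by cases x <;> simp
  le_trans x y z h1 h2 := by
    rcases x with a | ⟨i, s, hs⟩ <;> rcases y with b | ⟨k, t, ht⟩ <;>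
      rcases z with c | ⟨l, u, hu⟩ <;> simp only [node_le_node, node_le_bead, bead_le_node,
        bead_le_bead] at h1 h2 ⊢ <;> grind
  le_antisymm x y h1 h2 := by
    rcases x with a | ⟨i, s, hs⟩ <;> rcases y with b | ⟨k, t, ht⟩ <;>
      simp only [node_le_node, node_le_bead, bead_le_node,
        bead_le_bead, node.injEq, bead.injEq, reduceCtorEq] at h1 h2 ⊢ <;> grind

open Classical in
/-- The join of two elements. -/
noncomputable def sup (x y : S.Elem) : S.Elem :=
  if x ≤ y then y else if y ≤ x then x else node (max x.hi y.hi)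

open Classical in
/-- The meet of two elements. -/
noncomputable def inf (x y : S.Elem) : S.Elem :=
  if x ≤ y then x else if y ≤ x then y else node (min x.lo y.lo)

@[simp] lemma le_node_iff {x : S.Elem} {a : Fin (n + 1)} : x ≤ node a ↔ x.hi ≤ a := by
  cases x <;> simp

@[simp] lemma node_le_iff {x : S.Elem} {a : Fin (n + 1)} : node a ≤ x ↔ a ≤ x.lo := by
  cases x <;> simp

/-- If `z` were a bead on the strand of `x`, then `y ≤ z` would put `y` on that strand or below its
lower end, hence comparable with `x`. So a node separates `x` from every common upper bound; this is
what makes `sup` least. -/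
lemma hi_le_lo_of_le_of_le {x y z : S.Elem} (h1 : ¬ x ≤ y) (h2 : ¬ y ≤ x) (hx : x ≤ z)
    (hy : y ≤ z) : x.hi ≤ z.lo := by
  rcases x with a | ⟨i, s, hs⟩ <;> rcases y with b | ⟨k, t, ht⟩ <;>
    rcases z with c | ⟨l, u, hu⟩ <;> simp only [node_le_node, node_le_bead, bead_le_node,
      bead_le_bead, lo_node, lo_bead, hi_node, hi_bead] at h1 h2 hx hy ⊢ <;> grind

lemma hi_le_lo_of_ge_of_ge {x y z : S.Elem} (h1 : ¬ x ≤ y) (h2 : ¬ y ≤ x) (hx : z ≤ x)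
    (hy : z ≤ y) : z.hi ≤ x.lo := by
  rcases x with a | ⟨i, s, hs⟩ <;> rcases y with b | ⟨k, t, ht⟩ <;>
    rcases z with c | ⟨l, u, hu⟩ <;> simp only [node_le_node, node_le_bead, bead_le_node,
      bead_le_bead, lo_node, lo_bead, hi_node, hi_bead] at h1 h2 hx hy ⊢ <;> grind

noncomputable instance : Lattice S.Elem where
  sup := sup
  inf := inf
  le_sup_left x y := by
    unfold sup
    split_ifs
    · assumption
    · exact le_rfl
    · simp
  le_sup_right x y := by
    unfold sup
    split_ifs
    · exact le_rfl
    · assumption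
    · simp
  sup_le x y z hx hy := by
    unfold sup
    split_ifs with h1 h2
    · assumption
    · assumption
    · exact node_le_iff.2 (max_le (hi_le_lo_of_le_of_le h1 h2 hx hy)
        (hi_le_lo_of_le_of_le h2 h1 hy hx))
  inf_le_left x y := by
    unfold inf
    split_ifs
    · exact le_rfl
    · assumption
    · simp
  inf_le_right x y := by
    unfold inf
    split_ifs
    · assumption
    · exact le_rfl
    · simp
  le_inf z x y hx hy := by
    unfold inf
    split_ifs with h1 h2
    · assumption
    · assumption
    · exact le_node_iff.2 (le_min (hi_le_lo_of_ge_of_ge h1 h2 hx hy)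
        (hi_le_lo_of_ge_of_ge h2 h1 hy hx))

lemma sup_eq_node {x y : S.Elem} (h1 : ¬ x ≤ y) (h2 : ¬ y ≤ x) :
    x ⊔ y = node (max x.hi y.hi) := by
  change sup x y = _
  simp [sup, h1, h2]

lemma inf_eq_node {x y : S.Elem} (h1 : ¬ x ≤ y) (h2 : ¬ y ≤ x) :
    x ⊓ y = node (min x.lo y.lo) := by
  change inf x y = _
  simp [inf, h1, h2]

@[simp] lemma node_lt_node {a b : Fin (n + 1)} : (node a : S.Elem) < node b ↔ a < b := by
  rw [lt_iff_le_not_ge, lt_iff_le_not_ge]; simp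

@[simp] lemma node_lt_bead {a : Fin (n + 1)} {i : S.ι} {t : ℕ} {h : t < S.len i} :
    node a < bead i t h ↔ a ≤ S.src i := by
  rw [lt_iff_le_not_ge]
  simp
  exact fun h => h.trans_lt (S.src_lt_tgt i)

@[simp] lemma bead_lt_node {a : Fin (n + 1)} {i : S.ι} {t : ℕ} {h : t < S.len i} :
    bead i t h < node a ↔ S.tgt i ≤ a := by
  rw [lt_iff_le_not_ge]
  simp
  exact fun h => (S.src_lt_tgt i).trans_le h

@[simp] lemma bead_lt_bead {i k : S.ι} {s t : ℕ} {hs : s < S.len i} {ht : t < S.len k} :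
    bead i s hs < bead k t ht ↔ S.tgt i ≤ S.src k ∨ (i = k ∧ s < t) := by
  rw [lt_iff_le_not_ge, bead_le_bead, bead_le_bead]
  have := S.src_lt_tgt i
  have := S.src_lt_tgt k
  constructor
  · grind
  · rintro (h | ⟨rfl, h⟩)
    · refine ⟨Or.inl h, ?_⟩
      rintro (h' | ⟨rfl, _⟩)
      · exact absurd ((h'.trans_lt (S.src_lt_tgt i)).trans_le (h.trans (S.src_lt_tgt k).le))
          (lt_irrefl _)
      · exact absurd (h.trans_lt (S.src_lt_tgt _)) (lt_irrefl _)
    · refine ⟨Or.inr ⟨rfl, h.le⟩, ?_⟩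
      rintro (h' | ⟨_, h'⟩)
      · exact absurd (h'.trans_lt (S.src_lt_tgt _)) (lt_irrefl _)
      · omega

variable (S) in
/-- Elements as a sum type. -/
def equivSum : S.Elem ≃ Fin (n + 1) ⊕ (Σ i : S.ι, Fin (S.len i)) where
  toFun
    | node a => Sum.inl a
    | bead i t h => Sum.inr ⟨i, t, h⟩
  invFun
    | Sum.inl a => node a
    | Sum.inr ⟨i, t⟩ => bead i t t.2
  left_inv x := by cases x <;> rfl
  right_inv x := by rcases x with a | ⟨i, t, h⟩ <;> rfl

noncomputable instance : Fintype S.Elem := Fintype.ofEquiv _ (equivSum S).symm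

lemma card_elem : Nat.card S.Elem = n + 1 + ∑ i, S.len i := by
  rw [Nat.card_congr (equivSum S)]
  simp

noncomputable instance : BoundedOrder S.Elem where
  bot := node 0
  top := node (Fin.last n)
  bot_le x := by simp
  le_top x := by simpa using Fin.le_last _

end Elem
end StrandSystem

/-! ### Edges and components of a cover graph -/

section Nullity

variable {P : Type*} [PartialOrder P]

lemma ncard_edgeSet_hasse : (SimpleGraph.hasse P).edgeSet.ncard =
    Nat.card {p : P × P // p.1 ⋖ p.2} := by
  rw [← Nat.card_coe_set_eq]
  symm
  refine Nat.card_eq_of_bijective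
    (fun p => ⟨s(p.1.1, p.1.2), (SimpleGraph.mem_edgeSet _).2 (Or.inl p.2)⟩) ⟨?_, ?_⟩
  · rintro ⟨⟨a, b⟩, h⟩ ⟨⟨c, d⟩, h'⟩ heq
    simp only [Subtype.mk.injEq, Sym2.eq_iff] at heq
    rcases heq with ⟨rfl, rfl⟩ | ⟨rfl, rfl⟩
    · rfl
    · exact absurd (h.lt.trans h'.lt) (lt_irrefl _)
  · rintro ⟨e, he⟩
    induction e with
    | _ a b =>
      rcases (SimpleGraph.mem_edgeSet _).1 he with h | h
      · exact ⟨⟨(a, b), h⟩, rfl⟩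
      · exact ⟨⟨(b, a), h⟩, Subtype.ext Sym2.eq_swap⟩

lemma card_connectedComponent_hasse [Finite P] [BoundedOrder P] :
    Nat.card (SimpleGraph.hasse P).ConnectedComponent = 1 := by
  have key : ∀ x : P, (SimpleGraph.hasse P).Reachable ⊥ x := by
    intro x
    induction x using WellFoundedLT.induction with
    | _ x ih =>
      rcases eq_or_ne x ⊥ with rfl | hx
      · exact SimpleGraph.Reachable.refl _
      · obtain ⟨y, -, hy⟩ := exists_le_covBy_of_lt (bot_lt_iff_ne_bot.2 hx)
        exact (ih y hy.lt).trans (SimpleGraph.Adj.reachable (Or.inl hy))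
  rw [Nat.card_eq_one_iff_unique]
  refine ⟨⟨?_⟩, ⟨(SimpleGraph.hasse P).connectedComponentMk ⊥⟩⟩
  intro c d
  induction c using SimpleGraph.ConnectedComponent.ind with | _ c => ?_
  induction d using SimpleGraph.ConnectedComponent.ind with | _ d => ?_
  exact SimpleGraph.ConnectedComponent.sound ((key c).symm.trans (key d))

end Nullity

/-! ### Essential strands and reducible nodes -/

namespace StrandSystem

variable {n : ℕ} {S : StrandSystem n}

variable (S) in
/-- The number of strands from one node to another. -/
def mult (a b : Fin (n + 1)) : ℕ := #{i : S.ι | S.src i = a ∧ S.tgt i = b}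

/-- A strand whose beads cannot all be retracted: a node or another strand lies between its
ends. -/
def Essential (i : S.ι) : Prop :=
  (S.src i : ℕ) + 1 < S.tgt i ∨ ∃ k ≠ i, S.src k = S.src i ∧ S.tgt k = S.tgt i

/-- A subset containing all nodes and some bead of each essential strand. -/
structure IsSpanning (R : Set S.Elem) : Prop where
  node_mem : ∀ a, Elem.node a ∈ R
  exists_bead : ∀ i : S.ι, Essential i → ∃ t h, Elem.bead i t h ∈ R

lemma isSpanning_univ : IsSpanning (Set.univ : Set S.Elem) :=
  ⟨fun _ => trivial, fun i _ => ⟨0, S.len_pos i, trivial⟩⟩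

namespace Elem

lemma essential_symm {i k : S.ι} (hk : k ≠ i) (h1 : S.src k = S.src i)
    (h2 : S.tgt k = S.tgt i) : Essential k :=
  Or.inr ⟨i, hk.symm, h1.symm, h2.symm⟩

/-- A bead of the strand is joined with the node just above its lower end if the strand is long, and
with a bead of a parallel strand otherwise. The witnesses lie in `R` so that the same argument
serves the subposets met during retraction. -/
lemma exists_sup_eq_node {R : Set S.Elem} (hR : IsSpanning R) {i : S.ι} (hi : Essential i) :
    ∃ u ∈ R, ∃ v ∈ R, u ≠ node (S.tgt i) ∧ v ≠ node (S.tgt i) ∧ u ⊔ v = node (S.tgt i) := by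
  obtain ⟨t, h, ht⟩ := hR.exists_bead i hi
  have hlt := S.src_lt_tgt i
  rcases hi with h1 | ⟨k, hk, h1, h2⟩
  · have hb : (S.src i : ℕ) + 1 < n + 1 := by omega
    refine ⟨_, ht, _, hR.node_mem ⟨S.src i + 1, hb⟩, by simp, ?_, ?_⟩
    · simp only [ne_eq, node.injEq, Fin.ext_iff]; omega
    · rw [sup_eq_node]
      · simp only [hi_bead, hi_node, node.injEq, sup_eq_left, Fin.le_def]; omega
      · simp only [bead_le_node, Fin.le_def]; omega
      · simp only [node_le_bead, Fin.le_def]; omega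
  · obtain ⟨s, h', hs⟩ := hR.exists_bead k (essential_symm hk h1 h2)
    refine ⟨_, ht, _, hs, by simp, by simp, ?_⟩
    rw [sup_eq_node]
    · simp [h2]
    · simp [h1, Ne.symm hk, hlt]
    · simp [h2, hk, hlt]

lemma exists_inf_eq_node {R : Set S.Elem} (hR : IsSpanning R) {i : S.ι} (hi : Essential i) :
    ∃ u ∈ R, ∃ v ∈ R, u ≠ node (S.src i) ∧ v ≠ node (S.src i) ∧ u ⊓ v = node (S.src i) := by
  obtain ⟨t, h, ht⟩ := hR.exists_bead i hi
  have hlt := S.src_lt_tgt i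
  rcases hi with h1 | ⟨k, hk, h1, h2⟩
  · have hb : (S.src i : ℕ) + 1 < n + 1 := by omega
    refine ⟨_, ht, _, hR.node_mem ⟨S.src i + 1, hb⟩, by simp, ?_, ?_⟩
    · simp only [ne_eq, node.injEq, Fin.ext_iff]; omega
    · rw [inf_eq_node]
      · simp only [lo_bead, lo_node, node.injEq, inf_eq_left, Fin.le_def]; omega
      · simp only [bead_le_node, Fin.le_def]; omega
      · simp only [node_le_bead, Fin.le_def]; omega
  · obtain ⟨s, h', hs⟩ := hR.exists_bead k (essential_symm hk h1 h2)
    refine ⟨_, ht, _, hs, by simp, by simp, ?_⟩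
    rw [inf_eq_node]
    · simp [h1]
    · simp [h1, Ne.symm hk, hlt]
    · simp [h2, hk, hlt]

lemma not_le_of_sup {α : Type*} [Lattice α] {x y z : α} (hx : x ≠ z) (hy : y ≠ z)
    (h : x ⊔ y = z) : ¬ x ≤ y ∧ ¬ y ≤ x :=
  ⟨fun h' => hy (by rw [← h, sup_eq_right.2 h']), fun h' => hx (by rw [← h, sup_eq_left.2 h'])⟩

lemma not_le_of_inf {α : Type*} [Lattice α] {x y z : α} (hx : x ≠ z) (hy : y ≠ z)
    (h : x ⊓ y = z) : ¬ x ≤ y ∧ ¬ y ≤ x :=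
  ⟨fun h' => hx (by rw [← h, inf_eq_left.2 h']), fun h' => hy (by rw [← h, inf_eq_right.2 h'])⟩

/-- Here `x` is a bead. If its strand is not essential, it is alone in a gap, and an incomparable
`y` that does not reach higher must be a bead of another strand with the same upper end. That strand
starts lower, so it skips a node. -/
lemma exists_essential_of_hi_eq {x y : S.Elem} (h1 : ¬ x ≤ y) (h2 : ¬ y ≤ x) (hx : x ≠ node x.hi)
    (hxy : y.hi ≤ x.hi) (hy : y ≠ node x.hi) : ∃ i, Essential i ∧ S.tgt i = x.hi := by
  rcases x with a | ⟨i, s, hs⟩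
  · simp at hx
  simp only [hi_bead] at hxy hy ⊢
  by_cases hi : Essential i
  · exact ⟨i, hi, rfl⟩
  have hlt := S.src_lt_tgt i
  have hi' : ¬ (S.src i : ℕ) + 1 < S.tgt i := fun h => hi (Or.inl h)
  rcases y with b | ⟨k, t, ht⟩
  · simp only [node_le_bead, bead_le_node, hi_node, ne_eq, node.injEq] at *
    rw [Fin.le_def] at *
    rw [Fin.ext_iff] at *
    omega
  · simp only [bead_le_bead, hi_bead, not_or] at *
    have hlt' := S.src_lt_tgt k
    have htgt : S.tgt k = S.tgt i := by
      rw [Fin.le_def] at *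
      rw [Fin.ext_iff] at *
      omega
    have hki : k ≠ i := by
      rintro rfl
      simp only [true_and] at h1 h2
      omega
    refine ⟨k, ?_, htgt⟩
    by_cases hk : (S.src k : ℕ) + 1 < S.tgt k
    · exact Or.inl hk
    · refine Or.inr ⟨i, hki.symm, ?_, htgt.symm⟩
      rw [Fin.lt_def] at *
      rw [Fin.ext_iff] at *
      omega

lemma exists_essential_of_lo_eq {x y : S.Elem} (h1 : ¬ x ≤ y) (h2 : ¬ y ≤ x) (hx : x ≠ node x.lo)
    (hxy : x.lo ≤ y.lo) (hy : y ≠ node x.lo) : ∃ i, Essential i ∧ S.src i = x.lo := by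
  rcases x with a | ⟨i, s, hs⟩
  · simp at hx
  simp only [lo_bead] at hxy hy ⊢
  by_cases hi : Essential i
  · exact ⟨i, hi, rfl⟩
  have hlt := S.src_lt_tgt i
  have hi' : ¬ (S.src i : ℕ) + 1 < S.tgt i := fun h => hi (Or.inl h)
  rcases y with b | ⟨k, t, ht⟩
  · simp only [node_le_bead, bead_le_node, lo_node, ne_eq, node.injEq] at *
    rw [Fin.le_def] at *
    rw [Fin.ext_iff] at *
    omega
  · simp only [bead_le_bead, lo_bead, not_or] at *
    have hlt' := S.src_lt_tgt k
    have htgt : S.src k = S.src i := by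
      rw [Fin.le_def] at *
      rw [Fin.ext_iff] at *
      omega
    have hki : k ≠ i := by
      rintro rfl
      simp only [true_and] at h1 h2
      omega
    refine ⟨k, ?_, htgt⟩
    by_cases hk : (S.src k : ℕ) + 1 < S.tgt k
    · exact Or.inl hk
    · refine Or.inr ⟨i, hki.symm, htgt.symm, ?_⟩
      rw [Fin.lt_def] at *
      rw [Fin.ext_iff] at *
      omega

lemma joinReducible_node_iff {a : Fin (n + 1)} :
    JoinReducible (node a : S.Elem) ↔ ∃ i : S.ι, Essential i ∧ S.tgt i = a := by
  constructor
  · rintro ⟨x, y, hx, hy, h⟩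
    obtain ⟨h1, h2⟩ := not_le_of_sup hx hy h
    rw [sup_eq_node h1 h2] at h
    simp only [node.injEq] at h
    rcases le_total y.hi x.hi with h' | h'
    · rw [max_eq_left h'] at h
      subst h
      exact exists_essential_of_hi_eq h1 h2 hx h' hy
    · rw [max_eq_right h'] at h
      subst h
      exact exists_essential_of_hi_eq h2 h1 hy h' hx
  · rintro ⟨i, hi, rfl⟩
    obtain ⟨u, -, v, -, h⟩ := exists_sup_eq_node isSpanning_univ hi
    exact ⟨u, v, h⟩

lemma meetReducible_node_iff {a : Fin (n + 1)} :
    MeetReducible (node a : S.Elem) ↔ ∃ i : S.ι, Essential i ∧ S.src i = a := by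
  constructor
  · rintro ⟨x, y, hx, hy, h⟩
    obtain ⟨h1, h2⟩ := not_le_of_inf hx hy h
    rw [inf_eq_node h1 h2] at h
    simp only [node.injEq] at h
    rcases le_total x.lo y.lo with h' | h'
    · rw [min_eq_left h'] at h
      subst h
      exact exists_essential_of_lo_eq h1 h2 hx h' hy
    · rw [min_eq_right h'] at h
      subst h
      exact exists_essential_of_lo_eq h2 h1 hy h' hx
  · rintro ⟨i, hi, rfl⟩
    obtain ⟨u, -, v, -, h⟩ := exists_inf_eq_node isSpanning_univ hi
    exact ⟨u, v, h⟩

lemma isReducible_node_iff {a : Fin (n + 1)} : IsReducible (node a : S.Elem) ↔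
    ∃ i : S.ι, Essential i ∧ (S.tgt i = a ∨ S.src i = a) := by
  rw [IsReducible, joinReducible_node_iff, meetReducible_node_iff]
  grind

lemma not_isReducible_bead {i : S.ι} {t : ℕ} {h : t < S.len i} :
    ¬ IsReducible (bead i t h) := by
  rintro (⟨x, y, hx, hy, h'⟩ | ⟨x, y, hx, hy, h'⟩)
  · obtain ⟨h1, h2⟩ := not_le_of_sup hx hy h'
    rw [sup_eq_node h1 h2] at h'
    simp at h'
  · obtain ⟨h1, h2⟩ := not_le_of_inf hx hy h'
    rw [inf_eq_node h1 h2] at h'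
    simp at h'

lemma redSet_subset : redSet S.Elem ⊆ Set.range node := by
  rintro (a | ⟨i, t, h⟩) hx
  · exact ⟨a, rfl⟩
  · exact absurd hx not_isReducible_bead

lemma node_injective : Function.Injective (node : Fin (n + 1) → S.Elem) :=
  fun _ _ h => by simpa using h

/-- Only nodes can be reducible, so the number of reducible elements is maximal exactly when every
node is one. -/
lemma ncard_redSet_eq_iff : (redSet S.Elem).ncard = n + 1 ↔ ∀ a, IsReducible (node a : S.Elem) := by
  have hr : (Set.range (node : Fin (n + 1) → S.Elem)).ncard = n + 1 := by
    rw [Set.ncard_range_of_injective node_injective, Nat.card_fin]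
  constructor
  · intro h a
    have := Set.eq_of_subset_of_ncard_le redSet_subset (hr.trans h.symm).le
    have h2 : (node a : S.Elem) ∈ redSet S.Elem := this ▸ ⟨a, rfl⟩
    exact h2
  · intro h
    rw [← hr]
    congr 1
    refine redSet_subset.antisymm ?_
    rintro _ ⟨a, rfl⟩
    exact h a

lemma isRCLattice : IsRCLattice S.Elem := by
  intro x hx y hy _
  obtain ⟨a, rfl⟩ := redSet_subset hx
  obtain ⟨b, rfl⟩ := redSet_subset hy
  simpa using le_total a b

lemma isBlock (h : ∀ a, IsReducible (node a : S.Elem)) : IsBlock S.Elem :=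
  ⟨⟨_, fun x => bot_le (a := x), h 0⟩, ⟨_, fun x => le_top (a := x), h (Fin.last n)⟩⟩

/-! ### Coverings -/

lemma node_covBy_node_iff {a b : Fin (n + 1)} : (node a : S.Elem) ⋖ node b ↔
    (a : ℕ) + 1 = b ∧ ∀ i, ¬ (S.src i = a ∧ S.tgt i = b) := by
  constructor
  · rintro ⟨h1, h2⟩
    have hab : (a : ℕ) < b := by simpa using h1
    refine ⟨?_, ?_⟩
    · by_contra hne
      refine h2 (c := node ⟨a + 1, by omega⟩) ?_ ?_
      · simp only [node_lt_node, Fin.lt_def]; omega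
      · simp only [node_lt_node, Fin.lt_def]; omega
    · rintro i ⟨rfl, rfl⟩
      exact h2 (c := bead i 0 (S.len_pos i)) (by simp) (by simp)
  · rintro ⟨h1, h2⟩
    refine ⟨by simp only [node_lt_node, Fin.lt_def]; omega, ?_⟩
    rintro (c | ⟨i, t, h⟩) h3 h4
    · simp only [node_lt_node, Fin.lt_def] at h3 h4; omega
    · simp only [node_lt_bead, bead_lt_node] at h3 h4
      have := S.src_lt_tgt i
      refine h2 i ?_
      rw [Fin.le_def] at *
      rw [Fin.ext_iff, Fin.ext_iff]
      omega

lemma node_covBy_bead_iff {a : Fin (n + 1)} {i : S.ι} {t : ℕ} {h : t < S.len i} :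
    node a ⋖ bead i t h ↔ S.src i = a ∧ t = 0 := by
  constructor
  · rintro ⟨h1, h2⟩
    simp only [node_lt_bead] at h1
    refine ⟨?_, ?_⟩
    · by_contra hne
      exact h2 (c := node (S.src i)) (by simpa using lt_of_le_of_ne h1 (Ne.symm hne)) (by simp)
    · by_contra hne
      exact h2 (c := bead i 0 (S.len_pos i)) (by simpa using h1) (by simp; omega)
  · rintro ⟨rfl, rfl⟩
    refine ⟨by simp, ?_⟩
    have := S.src_lt_tgt i
    rintro (c | ⟨k, t, h⟩) h3 h4
    · simp only [node_lt_node, node_lt_bead] at h3 h4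
      exact absurd h3 h4.not_gt
    · simp only [node_lt_bead, bead_lt_bead] at h3 h4
      have := S.src_lt_tgt k
      rcases h4 with h4 | ⟨rfl, h4⟩
      · exact absurd (h3.trans_lt this) h4.not_gt
      · omega

variable (S) in
/-- The unique upper cover of a bead. -/
def next (i : S.ι) (t : ℕ) : S.Elem :=
  if h : t + 1 < S.len i then bead i (t + 1) h else node (S.tgt i)

lemma bead_lt_iff_next_le {i : S.ι} {t : ℕ} {h : t < S.len i} {y : S.Elem} :
    bead i t h < y ↔ next S i t ≤ y := by
  unfold next
  have := S.src_lt_tgt i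
  rcases y with b | ⟨k, s, hs⟩
  · split_ifs <;> simp
  · split_ifs with h'
    · simp only [bead_lt_bead, bead_le_bead, Nat.succ_le_iff]
    · simp only [bead_lt_bead, node_le_bead, or_iff_left_iff_imp]
      rintro ⟨rfl, _⟩
      omega

lemma bead_covBy_iff {i : S.ι} {t : ℕ} {h : t < S.len i} {y : S.Elem} :
    bead i t h ⋖ y ↔ y = next S i t := by
  constructor
  · rintro ⟨h1, h2⟩
    by_contra hne
    have h3 := bead_lt_iff_next_le.1 h1
    exact h2 (bead_lt_iff_next_le.2 le_rfl) (lt_of_le_of_ne h3 (Ne.symm hne))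
  · rintro rfl
    refine ⟨bead_lt_iff_next_le.2 le_rfl, fun c h1 h2 => ?_⟩
    exact absurd (bead_lt_iff_next_le.1 h1) h2.not_ge

lemma mult_eq_zero_iff {a b : Fin (n + 1)} :
    S.mult a b = 0 ↔ ∀ i, ¬ (S.src i = a ∧ S.tgt i = b) := by
  simp [mult, Finset.filter_eq_empty_iff]

variable (S) in
/-- The coverings of the lattice of a strand system. -/
def cover : {b : Fin n // S.mult b.castSucc b.succ = 0} ⊕ (S.ι ⊕ Σ i, Fin (S.len i)) →
    {p : S.Elem × S.Elem // p.1 ⋖ p.2}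
  | .inl b => ⟨(node b.1.castSucc, node b.1.succ),
      node_covBy_node_iff.2 ⟨by simp, mult_eq_zero_iff.1 b.2⟩⟩
  | .inr (.inl i) => ⟨(node (S.src i), bead i 0 (S.len_pos i)), node_covBy_bead_iff.2 ⟨rfl, rfl⟩⟩
  | .inr (.inr ⟨i, t⟩) => ⟨(bead i t t.2, next S i t), bead_covBy_iff.2 rfl⟩

/-- A bead has a single upper cover. A node is covered by the first bead of each strand that starts
there, and by the next node only if the gap between them is empty. -/
lemma cover_bijective : Function.Bijective (cover S) := by
  constructor
  · rintro (⟨b, hb⟩ | i | ⟨i, t, ht⟩) (⟨c, hc⟩ | k | ⟨k, s, hs⟩) h <;>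
      simp_all [cover, Subtype.ext_iff]
    obtain ⟨⟨rfl, rfl⟩, -⟩ := h
    rfl
  · rintro ⟨⟨a | ⟨i, t, ht⟩, y⟩, h⟩
    · rcases y with b | ⟨i, t, ht⟩
      · have h' := node_covBy_node_iff.1 h
        have hb : (a : ℕ) < n := by omega
        have h1 : a = (⟨a, hb⟩ : Fin n).castSucc := rfl
        have h2 : b = (⟨a, hb⟩ : Fin n).succ := Fin.ext h'.1.symm
        refine ⟨.inl ⟨⟨a, hb⟩, mult_eq_zero_iff.2 ?_⟩, ?_⟩
        · rw [← h1, ← h2]; exact h'.2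
        · exact Subtype.ext (Prod.ext (congrArg node h1.symm) (congrArg node h2.symm))
      · obtain ⟨rfl, rfl⟩ := node_covBy_bead_iff.1 h
        exact ⟨.inr (.inl i), rfl⟩
    · obtain rfl := bead_covBy_iff.1 h
      exact ⟨.inr (.inr ⟨i, t, ht⟩), rfl⟩

/-- Each bead accounts for one vertex and for one edge, the one leading up from it, so the beads
cancel. There remain one edge at the foot of each strand, one per empty gap, `n + 1` vertices and
one component. -/
lemma nullity_eq : nullity S.Elem =
    Fintype.card S.ι + (#{b : Fin n | S.mult b.castSucc b.succ = 0} : ℤ) - n := by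
  rw [nullity, ncard_edgeSet_hasse, card_connectedComponent_hasse, card_elem,
    ← Nat.card_eq_of_bijective _ cover_bijective]
  simp only [Nat.card_eq_fintype_card, Fintype.card_sum, Fintype.card_sigma, Fintype.card_fin,
    Fintype.card_subtype]
  push_cast
  ring

end Elem
end StrandSystem

/-! ### Covers and retracts in subposets -/

section Subposet

/-- If `u` and `v` lay below the same lower cover of `x`, so would their join `x`. The join is that
of the ambient lattice; `R` need not be a sublattice. -/
lemma exists_covBy_pair_of_sup {α : Type*} [Lattice α] [Finite α] {R : Set α} {x u v : R}
    (hu : u ≠ x) (hv : v ≠ x) (h : (u : α) ⊔ v = x) : ∃ y z : R, y ⋖ x ∧ z ⋖ x ∧ y ≠ z := by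
  have hux : u < x := lt_of_le_of_ne (Subtype.coe_le_coe.1 (h ▸ le_sup_left)) hu
  have hvx : v < x := lt_of_le_of_ne (Subtype.coe_le_coe.1 (h ▸ le_sup_right)) hv
  obtain ⟨y, hy, hyx⟩ := exists_le_covBy_of_lt hux
  obtain ⟨z, hz, hzx⟩ := exists_le_covBy_of_lt hvx
  refine ⟨y, z, hyx, hzx, ?_⟩
  rintro rfl
  have : (x : α) ≤ y := h ▸ sup_le hy hz
  exact hyx.lt.not_ge this

lemma exists_covBy_pair_of_inf {α : Type*} [Lattice α] [Finite α] {R : Set α} {x u v : R}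
    (hu : u ≠ x) (hv : v ≠ x) (h : (u : α) ⊓ v = x) : ∃ y z : R, x ⋖ y ∧ x ⋖ z ∧ y ≠ z := by
  have hux : x < u := lt_of_le_of_ne (Subtype.coe_le_coe.1 (h ▸ inf_le_left)) hu.symm
  have hvx : x < v := lt_of_le_of_ne (Subtype.coe_le_coe.1 (h ▸ inf_le_right)) hv.symm
  obtain ⟨y, hyx, hy⟩ := exists_covBy_le_of_lt hux
  obtain ⟨z, hzx, hz⟩ := exists_covBy_le_of_lt hvx
  refine ⟨y, z, hyx, hzx, ?_⟩
  rintro rfl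
  have : (y : α) ≤ x := h ▸ le_inf hy hz
  exact hyx.lt.not_ge this

variable {P : Type*} [PartialOrder P]

lemma IsPendant.eq_of_adj {x y z : P} (h : IsPendant x) (hy : y ⋖ x ∨ x ⋖ y)
    (hz : z ⋖ x ∨ x ⋖ z) : y = z :=
  h.unique (hy.symm) (hz.symm)

lemma isRetractible_of_forall {x y z : P} (hy : y < x) (hy' : ∀ w < x, w ≤ y) (hz : x < z)
    (hz' : ∀ w > x, z ≤ w) (h : ∀ w, y < w → w < z → w = x) : IsRetractible x := by
  refine ⟨y, z, fun w => ⟨fun hw => ?_, ?_⟩, fun w => ⟨fun hw => ?_, ?_⟩, h⟩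
  · by_contra hne
    exact hw.2 (lt_of_le_of_ne (hy' w hw.lt) hne) hy
  · rintro rfl
    exact ⟨hy, fun c hc hcx => (hy' c hcx).not_gt hc⟩
  · by_contra hne
    exact hw.2 hz (lt_of_le_of_ne (hz' w hw.lt) (Ne.symm hne))
  · rintro rfl
    exact ⟨hz, fun c hc hcx => (hz' c hc).not_gt hcx⟩

lemma exists_isBasicRetractOf [Finite P] : ∃ R : Set P, IsBasicRetractOf R := by
  have key : ∀ (m : ℕ) (R : Set P), R.ncard = m → ∃ T, Relation.ReflTransGen RetractStep R T ∧
      ∀ x : T, ¬ IsRetractible x := by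
    intro m
    induction m with
    | zero =>
      intro R hR
      refine ⟨R, .refl, fun x => ?_⟩
      rw [Set.ncard_eq_zero] at hR
      exact absurd x.2 (by simp [hR])
    | succ m ih =>
      intro R hR
      by_cases h : ∃ x : R, IsRetractible x
      · obtain ⟨x, hx⟩ := h
        obtain ⟨T, hT, hT'⟩ := ih (R \ {(x : P)}) (by
          have := Set.ncard_sdiff_singleton_add_one x.2
          omega)
        exact ⟨T, .head ⟨x, hx, rfl⟩ hT, hT'⟩
      · exact ⟨R, .refl, fun x hx => h ⟨x, hx⟩⟩
  obtain ⟨T, h⟩ := key _ Set.univ rfl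
  exact ⟨T, h⟩

end Subposet

/-! ### Basic retracts of the lattice of a strand system -/

namespace StrandSystem

variable {n : ℕ} {S : StrandSystem n}

namespace Elem

lemma IsSpanning.node_covBy_pair {R : Set S.Elem} (hR : IsSpanning R)
    (hS : ∀ a, IsReducible (node a : S.Elem)) {x : R} {a : Fin (n + 1)} (hx : (x : S.Elem) = node a) :
    (∃ y z : R, y ⋖ x ∧ z ⋖ x ∧ y ≠ z) ∨ ∃ y z : R, x ⋖ y ∧ x ⋖ z ∧ y ≠ z := by
  obtain ⟨i, hi, rfl | rfl⟩ := isReducible_node_iff.1 (hS a)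
  · obtain ⟨u, hu, v, hv, hu', hv', h⟩ := exists_sup_eq_node hR hi
    rw [← hx] at hu' hv' h
    exact .inl (exists_covBy_pair_of_sup (u := ⟨u, hu⟩) (v := ⟨v, hv⟩)
      (fun h => hu' (congrArg Subtype.val h)) (fun h => hv' (congrArg Subtype.val h)) h)
  · obtain ⟨u, hu, v, hv, hu', hv', h⟩ := exists_inf_eq_node hR hi
    rw [← hx] at hu' hv' h
    exact .inr (exists_covBy_pair_of_inf (u := ⟨u, hu⟩) (v := ⟨v, hv⟩)
      (fun h => hu' (congrArg Subtype.val h)) (fun h => hv' (congrArg Subtype.val h)) h)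

/-- A reducible node keeps two covers on one side, and a bead has neighbours on both sides because
the ends of its strand are present. -/
lemma IsSpanning.not_isPendant {R : Set S.Elem} (hR : IsSpanning R)
    (hS : ∀ a, IsReducible (node a : S.Elem)) (x : R) : ¬ IsPendant x := by
  intro hx
  rcases hxe : (x : S.Elem) with a | ⟨i, t, ht⟩
  · rcases IsSpanning.node_covBy_pair hR hS hxe with ⟨y, z, hy, hz, hne⟩ | ⟨y, z, hy, hz, hne⟩
    · exact hne (hx.eq_of_adj (.inl hy) (.inl hz))
    · exact hne (hx.eq_of_adj (.inr hy) (.inr hz))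
  · obtain ⟨y, -, hy⟩ := exists_le_covBy_of_lt (a := (⟨_, hR.node_mem (S.src i)⟩ : R)) (b := x)
      (by rw [← Subtype.coe_lt_coe, hxe]; simp)
    obtain ⟨z, hz, -⟩ := exists_covBy_le_of_lt (b := (⟨_, hR.node_mem (S.tgt i)⟩ : R)) (a := x)
      (by rw [← Subtype.coe_lt_coe, hxe]; simp)
    have := hx.eq_of_adj (.inl hy) (.inr hz)
    exact absurd (this ▸ hy.lt) hz.lt.not_gt

lemma IsSpanning.not_isRetractible {R : Set S.Elem} (hR : IsSpanning R)
    (hS : ∀ a, IsReducible (node a : S.Elem)) {x : R} {a : Fin (n + 1)}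
    (hx : (x : S.Elem) = node a) : ¬ IsRetractible x := by
  rintro ⟨y', z', h1, h2, -⟩
  rcases IsSpanning.node_covBy_pair hR hS hx with ⟨y, z, hy, hz, hne⟩ | ⟨y, z, hy, hz, hne⟩
  · exact hne (((h1 y).1 hy).trans ((h1 z).1 hz).symm)
  · exact hne (((h2 y).1 hy).trans ((h2 z).1 hz).symm)

/-- Nodes have too many covers to be retractible. If the last bead of an essential strand were, its
lower cover would lie at or below the lower end of the strand and its upper cover at or above the
upper end; between them sits a skipped node or a bead of a parallel strand, which is a second path.
-/
lemma IsSpanning.retractStep {R T : Set S.Elem} (hR : IsSpanning R)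
    (hS : ∀ a, IsReducible (node a : S.Elem)) (h : RetractStep R T) : IsSpanning T := by
  obtain ⟨x, hx, rfl⟩ := h
  refine ⟨fun a => ⟨hR.node_mem a, fun h => ?_⟩, fun i hi => ?_⟩
  · exact IsSpanning.not_isRetractible hR hS (x := x) (a := a) (by simpa using h.symm) hx
  · by_contra! hne
    obtain ⟨t, ht, htR⟩ := hR.exists_bead i hi
    have hxt : ∀ s hs, bead i s hs ∈ R → bead i s hs = (x : S.Elem) := by
      intro s hs hsR
      by_contra hn
      exact hne s hs ⟨hsR, by simpa using hn⟩
    have hx' := hxt t ht htR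
    obtain ⟨y, z, h1, h2, h3⟩ := hx
    have hlt := S.src_lt_tgt i
    have hyx : y < x := ((h1 y).2 rfl).lt
    have hxz : x < z := ((h2 z).2 rfl).lt
    have hy : ∀ w : R, w < x → w ≤ y := fun w hw => by
      obtain ⟨c, hc, hc'⟩ := exists_le_covBy_of_lt hw
      exact ((h1 c).1 hc') ▸ hc
    have hz : ∀ w : R, x < w → z ≤ w := fun w hw => by
      obtain ⟨c, hc', hc⟩ := exists_covBy_le_of_lt hw
      exact ((h2 c).1 hc') ▸ hc
    have hy1 : (y : S.Elem) ≤ node (S.src i) := by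
      have h4 : (y : S.Elem) < bead i t ht := hx' ▸ hyx
      rcases hye : (y : S.Elem) with b | ⟨k, s, hs⟩
      · rw [hye] at h4; simpa using h4
      · rw [hye] at h4
        rcases bead_lt_bead.1 h4 with h4 | ⟨rfl, h4⟩
        · simpa using h4
        · have := (hxt s hs (hye ▸ y.2)).trans hx'.symm
          simp at this
          omega
    have hz1 : node (S.tgt i) ≤ (z : S.Elem) := by
      have h4 : bead i t ht < (z : S.Elem) := hx' ▸ hxz
      rcases hze : (z : S.Elem) with b | ⟨k, s, hs⟩
      · rw [hze] at h4; simpa using h4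
      · rw [hze] at h4
        rcases bead_lt_bead.1 h4 with h4 | ⟨rfl, h4⟩
        · simpa using h4
        · have := (hxt s hs (hze ▸ z.2)).trans hx'.symm
          simp at this
          omega
    have hw : ∀ w : R, node (S.src i) < (w : S.Elem) → (w : S.Elem) < node (S.tgt i) → w = x :=
      fun w hw1 hw2 => h3 w (hy1.trans_lt hw1) (hw2.trans_le hz1)
    rcases hi with hi | ⟨k, hk, hk1, hk2⟩
    · have hb : (S.src i : ℕ) + 1 < n + 1 := by omega
      have := hw ⟨_, hR.node_mem ⟨S.src i + 1, hb⟩⟩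
        (by simp [Fin.lt_def]) (by simp only [node_lt_node, Fin.lt_def]; omega)
      rw [← this] at hx'
      simp at hx'
    · obtain ⟨s, hs, hsR⟩ := hR.exists_bead k (essential_symm hk hk1 hk2)
      have := hw ⟨_, hsR⟩ (by simp [hk1]) (by simp [hk2])
      rw [← this] at hx'
      simp [Ne.symm hk] at hx'

/-- The lowest of at least two surviving beads can always go: below it comes the lower end of the
strand, above it the next surviving bead, and nothing else lies between these. -/
lemma IsSpanning.isRetractible_of_next {R : Set S.Elem} (hR : IsSpanning R) {i : S.ι} {t s : ℕ}
    {ht : t < S.len i} {hs : s < S.len i} (htR : bead i t ht ∈ R) (hsR : bead i s hs ∈ R)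
    (hts : t < s) (hmin : ∀ u hu, bead i u hu ∈ R → t ≤ u)
    (hnext : ∀ u hu, bead i u hu ∈ R → t < u → s ≤ u) :
    IsRetractible (⟨_, htR⟩ : R) := by
  have hlt := S.src_lt_tgt i
  refine isRetractible_of_forall (y := ⟨_, hR.node_mem (S.src i)⟩) (z := ⟨_, hsR⟩)
    (Subtype.coe_lt_coe.1 (by simp)) ?_ (Subtype.coe_lt_coe.1 (by simp [hts])) ?_ ?_
  · rintro ⟨b | ⟨k, u, hu⟩, hw⟩ h
    · simpa [← Subtype.coe_lt_coe] using h
    · rcases bead_lt_bead.1 (Subtype.coe_lt_coe.2 h) with h | ⟨rfl, h⟩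
      · simpa [← Subtype.coe_le_coe] using h
      · exact absurd (hmin u hu hw) (by omega)
  · rintro ⟨b | ⟨k, u, hu⟩, hw⟩ h
    · simpa [← Subtype.coe_lt_coe] using h
    · rcases bead_lt_bead.1 (Subtype.coe_lt_coe.2 h) with h | ⟨rfl, h'⟩
      · exact bead_le_bead.2 (.inl h)
      · exact bead_le_bead.2 (.inr ⟨rfl, hnext u hu hw h'⟩)
  · rintro ⟨b | ⟨k, u, hu⟩, hw⟩ h1 h2
    · have h1' := node_lt_node.1 (Subtype.coe_lt_coe.2 h1)
      have h2' := node_lt_bead.1 (Subtype.coe_lt_coe.2 h2)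
      exact absurd h1' h2'.not_gt
    · have h1' := node_lt_bead.1 (Subtype.coe_lt_coe.2 h1)
      have := S.src_lt_tgt k
      rcases bead_lt_bead.1 (Subtype.coe_lt_coe.2 h2) with h2' | ⟨rfl, h2'⟩
      · exact absurd (h1'.trans_lt this) h2'.not_gt
      · have h3 := hmin u hu hw
        have h4 : ¬ t < u := fun h4 => absurd (hnext u hu hw h4) (by omega)
        obtain rfl : t = u := by omega
        rfl

lemma IsSpanning.isRetractible_of_unique {R : Set S.Elem} (hR : IsSpanning R) {i : S.ι} {t : ℕ}
    {ht : t < S.len i} (htR : bead i t ht ∈ R) (hi : ¬ Essential i)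
    (huniq : ∀ u hu, bead i u hu ∈ R → u = t) : IsRetractible (⟨_, htR⟩ : R) := by
  have hlt := S.src_lt_tgt i
  refine isRetractible_of_forall (y := ⟨_, hR.node_mem (S.src i)⟩)
    (z := ⟨_, hR.node_mem (S.tgt i)⟩)
    (Subtype.coe_lt_coe.1 (by simp)) ?_ (Subtype.coe_lt_coe.1 (by simp)) ?_ ?_
  · rintro ⟨b | ⟨k, u, hu⟩, hw⟩ h
    · simpa [← Subtype.coe_lt_coe] using h
    · rcases bead_lt_bead.1 (Subtype.coe_lt_coe.2 h) with h | ⟨rfl, h⟩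
      · simpa [← Subtype.coe_le_coe] using h
      · exact absurd (huniq u hu hw) (by omega)
  · rintro ⟨b | ⟨k, u, hu⟩, hw⟩ h
    · simpa [← Subtype.coe_lt_coe] using h
    · rcases bead_lt_bead.1 (Subtype.coe_lt_coe.2 h) with h | ⟨rfl, h⟩
      · simpa [← Subtype.coe_le_coe] using h
      · exact absurd (huniq u hu hw) (by omega)
  · have hi' : ¬ (S.src i : ℕ) + 1 < S.tgt i := fun h => hi (Or.inl h)
    rintro ⟨b | ⟨k, u, hu⟩, hw⟩ h1 h2
    · have h1' := node_lt_node.1 (Subtype.coe_lt_coe.2 h1)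
      have h2' := node_lt_node.1 (Subtype.coe_lt_coe.2 h2)
      rw [Fin.lt_def] at h1' h2'
      omega
    · have h1' := node_lt_bead.1 (Subtype.coe_lt_coe.2 h1)
      have h2' := bead_lt_node.1 (Subtype.coe_lt_coe.2 h2)
      have := S.src_lt_tgt k
      have hk : k = i := by
        by_contra hk
        refine hi (.inr ⟨k, hk, ?_, ?_⟩) <;> rw [Fin.ext_iff] <;> rw [Fin.le_def] at h1' h2' <;>
          omega
      subst hk
      obtain rfl := huniq u hu hw
      rfl

/-- Together with `IsSpanning.exists_bead` this pins down every terminal subposet: exactly one bead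
on each essential strand, none on the others. -/
lemma IsSpanning.essential_and_unique {R : Set S.Elem} (hR : IsSpanning R)
    (h : ∀ x : R, ¬ IsRetractible x) {i : S.ι} {t : ℕ} {ht : t < S.len i}
    (htR : bead i t ht ∈ R) : Essential i ∧ ∀ u hu, bead i u hu ∈ R → u = t := by
  classical
  let U : Set ℕ := {u | ∃ hu, bead i u hu ∈ R}
  have hU : U.Nonempty := ⟨t, ht, htR⟩
  obtain ⟨hm, hmR⟩ := Nat.sInf_mem hU
  have hmin : ∀ u hu, bead i u hu ∈ R → sInf U ≤ u := fun u hu huR => Nat.sInf_le ⟨hu, huR⟩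
  let V : Set ℕ := {u | (∃ hu, bead i u hu ∈ R) ∧ sInf U < u}
  by_cases hV : V.Nonempty
  · obtain ⟨⟨hv, hvR⟩, hlt⟩ := Nat.sInf_mem hV
    exact absurd (IsSpanning.isRetractible_of_next hR hmR hvR hlt hmin
      fun u hu huR h => Nat.sInf_le ⟨⟨hu, huR⟩, h⟩) (h _)
  · have huniq : ∀ u hu, bead i u hu ∈ R → u = sInf U := fun u hu huR => by
      by_contra hne
      exact hV ⟨u, ⟨hu, huR⟩, lt_of_le_of_ne (hmin u hu huR) (Ne.symm hne)⟩
    refine ⟨?_, fun u hu huR => (huniq u hu huR).trans (huniq t ht htR).symm⟩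
    by_contra hi
    exact h _ (IsSpanning.isRetractible_of_unique hR hmR hi huniq)

end Elem
end StrandSystem

/-! ### The height of the basic block -/

namespace StrandSystem

variable {n : ℕ} {S : StrandSystem n}

variable (S) in
/-- The height difference of two consecutive nodes in a basic block. -/
def gap (b : Fin n) : ℕ := if 2 ≤ S.mult b.castSucc b.succ then 2 else 1

variable (S) in
/-- The height of a node in a basic block. -/
def rk (a : Fin (n + 1)) : ℕ := Fin.partialSum S.gap a

lemma rk_zero : S.rk 0 = 0 := Fin.partialSum_zero _

lemma rk_succ (b : Fin n) : S.rk b.succ = S.rk b.castSucc + S.gap b := Fin.partialSum_succ _ _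

lemma one_le_gap (b : Fin n) : 1 ≤ S.gap b := by unfold gap; split_ifs <;> omega

lemma rk_last : S.rk (Fin.last n) = n + #{b : Fin n | 2 ≤ S.mult b.castSucc b.succ} := by
  have h : S.rk (Fin.last n) = ∑ b, S.gap b := by
    simp [rk, Fin.partialSum, List.take_of_length_le, List.sum_ofFn]
  have hg : ∀ b, S.gap b = 1 + if 2 ≤ S.mult b.castSucc b.succ then 1 else 0 := by
    intro b; unfold gap; split_ifs <;> rfl
  rw [h, sum_congr rfl fun b _ => hg b, sum_add_distrib]
  simp

lemma rk_add_le {a b : Fin (n + 1)} (h : a ≤ b) : S.rk a + (b - a : ℕ) ≤ S.rk b := by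
  induction b using Fin.induction with
  | zero =>
    obtain rfl : a = 0 := Fin.le_zero_iff.1 h
    simp
  | succ b ih =>
    rcases h.eq_or_lt with rfl | h
    · simp
    · have hab : a ≤ b.castSucc := Fin.le_castSucc_iff.2 h
      have := ih hab
      have := one_le_gap (S := S) b
      rw [rk_succ]
      rw [Fin.le_def] at hab
      simp only [Fin.val_succ, Fin.val_castSucc] at *
      omega

lemma rk_mono {a b : Fin (n + 1)} (h : a ≤ b) : S.rk a ≤ S.rk b :=
  le_trans (Nat.le_add_right _ _) (rk_add_le h)

lemma two_le_mult_iff {a b : Fin (n + 1)} : 2 ≤ S.mult a b ↔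
    ∃ i k : S.ι, i ≠ k ∧ (S.src i = a ∧ S.tgt i = b) ∧ (S.src k = a ∧ S.tgt k = b) := by
  rw [mult, Nat.succ_le_iff, Finset.one_lt_card]
  simp only [mem_filter, mem_univ, true_and]
  grind

/-- A long strand spans at least two gaps, each of height at least one; a short essential strand
lies in a multiple gap, of height two. This leaves room for the surviving bead strictly between its
ends. -/
lemma rk_add_two_le {i : S.ι} (hi : Essential i) : S.rk (S.src i) + 2 ≤ S.rk (S.tgt i) := by
  have hlt := S.src_lt_tgt i
  by_cases h : (S.src i : ℕ) + 1 < S.tgt i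
  · have := rk_add_le (S := S) hlt.le
    omega
  · rcases hi with hi | ⟨k, hk, hk1, hk2⟩
    · exact absurd hi h
    · have hb : (S.src i : ℕ) < n := by omega
      have h1 : S.src i = (⟨S.src i, hb⟩ : Fin n).castSucc := rfl
      have h2 : S.tgt i = (⟨S.src i, hb⟩ : Fin n).succ := by
        rw [Fin.ext_iff]
        simp only [Fin.val_succ]
        omega
      have h3 : 2 ≤ S.mult (S.src i) (S.tgt i) :=
        two_le_mult_iff.2 ⟨i, k, hk.symm, ⟨rfl, rfl⟩, hk1, hk2⟩
      rw [h2, rk_succ, ← h1, gap, ← h1, ← h2, if_pos h3]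

namespace Elem

/-- The height of an element in a basic block. -/
def rk : S.Elem → ℕ
  | node a => S.rk a
  | bead i _ _ => S.rk (S.src i) + 1

lemma rk_le (x : S.Elem) : x.rk ≤ S.rk (Fin.last n) := by
  rcases x with a | ⟨i, t, ht⟩
  · exact rk_mono (Fin.le_last _)
  · have h := rk_add_le (S := S) (S.src_lt_tgt i).le
    have h2 := rk_mono (S := S) (Fin.le_last (S.tgt i))
    have := S.src_lt_tgt i
    change S.rk (S.src i) + 1 ≤ _
    omega

lemma IsSpanning.krullDim_eq {R : Set S.Elem} (hR : IsSpanning R)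
    (h : ∀ x : R, ¬ IsRetractible x) :
    Order.krullDim R = ((n + #{b : Fin n | 2 ≤ S.mult b.castSucc b.succ} : ℕ) : WithBot ℕ∞) := by
  rw [← rk_last]
  apply le_antisymm
  -- Upper bound: the rank is strictly increasing on `R`, so chains are no longer than the rank of
  -- the top node.
  · have hmono : StrictMono fun x : R => (⟨x.1.rk, Nat.lt_succ_of_le (rk_le _)⟩ :
        Fin (S.rk (Fin.last n) + 1)) := by
      rintro ⟨x, hx⟩ ⟨y, hy⟩ hlt
      rw [← Subtype.coe_lt_coe] at hlt
      rw [Fin.lt_def]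
      change x.rk < y.rk
      dsimp only at hlt
      rcases x with a | ⟨i, t, ht⟩ <;> rcases y with b | ⟨k, s, hs⟩
      · have hab := node_lt_node.1 hlt
        have := rk_add_le (S := S) hab.le
        change S.rk a < S.rk b
        omega
      · exact Nat.lt_succ_of_le (rk_mono (node_lt_bead.1 hlt))
      · have h1 := rk_add_two_le (IsSpanning.essential_and_unique hR h hx).1
        have h2 := rk_mono (S := S) (bead_lt_node.1 hlt)
        change S.rk (S.src i) + 1 < S.rk b
        omega
      · rcases bead_lt_bead.1 hlt with h3 | ⟨rfl, h3⟩
        · have h1 := rk_add_two_le (IsSpanning.essential_and_unique hR h hx).1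
          have h2 := rk_mono (S := S) h3
          change S.rk (S.src i) + 1 < S.rk (S.src k) + 1
          omega
        · have := (IsSpanning.essential_and_unique hR h hx).2 s hs hy
          omega
    refine (Order.krullDim_le_of_strictMono _ hmono).trans ?_
    refine iSup_le fun l => ?_
    have := l.length_lt_card
    rw [Fintype.card_fin] at this
    exact_mod_cast Nat.le_of_lt_succ this
  -- Lower bound: climb node by node, passing through a surviving bead in each multiple gap.
  · have key : ∀ a, (S.rk a : ℕ∞) ≤ Order.height (⟨_, hR.node_mem a⟩ : R) := by
      intro a
      induction a using Fin.induction with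
      | zero => simp [rk_zero]
      | succ b ih =>
        rw [rk_succ]
        unfold gap
        split_ifs with h2
        · obtain ⟨i, k, hik, ⟨hi1, hi2⟩, hk1, hk2⟩ := two_le_mult_iff.1 h2
          obtain ⟨t, ht, htR⟩ := hR.exists_bead i
            (.inr ⟨k, hik.symm, hk1.trans hi1.symm, hk2.trans hi2.symm⟩)
          have e1 := Order.height_add_one_le (a := (⟨_, hR.node_mem b.castSucc⟩ : R))
            (b := ⟨_, htR⟩) (Subtype.coe_lt_coe.1 (by simp [hi1]))
          have e2 := Order.height_add_one_le (b := (⟨_, hR.node_mem b.succ⟩ : R))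
            (a := ⟨_, htR⟩) (Subtype.coe_lt_coe.1 (by simp [hi2]))
          refine le_trans ?_ e2
          refine le_trans ?_ (add_le_add_left e1 1)
          rw [add_assoc, one_add_one_eq_two]
          push_cast
          gcongr
        · have e1 := Order.height_add_one_le (a := (⟨_, hR.node_mem b.castSucc⟩ : R))
            (b := ⟨_, hR.node_mem b.succ⟩) (Subtype.coe_lt_coe.1 (by simp))
          refine le_trans ?_ e1
          push_cast
          gcongr
    refine le_trans ?_ (Order.height_le_krullDim (⟨_, hR.node_mem (Fin.last n)⟩ : R))
    exact_mod_cast key (Fin.last n)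

lemma isSpanning_of_reflTransGen (hS : ∀ a, IsReducible (node a : S.Elem)) {R : Set S.Elem}
    (h : Relation.ReflTransGen RetractStep Set.univ R) : IsSpanning R := by
  induction h with
  | refl => exact isSpanning_univ
  | tail _ h ih => exact IsSpanning.retractStep ih hS h

/-- The height of a basic block. -/
lemma exists_isBasicBlockOf_krullDim_eq_iff (hS : ∀ a, IsReducible (node a : S.Elem)) (m : ℕ) :
    (∃ B : Set S.Elem, IsBasicBlockOf B ∧ Order.krullDim B = (m : WithBot ℕ∞)) ↔
      n + #{b : Fin n | 2 ≤ S.mult b.castSucc b.succ} = m := by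
  constructor
  · rintro ⟨B, ⟨R, ⟨hR, hR'⟩, hB, -⟩, h⟩
    have hsp := isSpanning_of_reflTransGen hS hR
    -- A spanning set has no pendant vertex, so the second deletion phase is empty and `B` equals
    -- `R`.
    rcases Relation.ReflTransGen.cases_head hB with rfl | ⟨T, ⟨x, hx, -⟩, -⟩
    · rw [IsSpanning.krullDim_eq hsp hR'] at h
      exact_mod_cast h
    · exact absurd hx (IsSpanning.not_isPendant hsp hS x)
  · intro h
    obtain ⟨R, hR, hR'⟩ := exists_isBasicRetractOf (P := S.Elem)
    have hsp := isSpanning_of_reflTransGen hS hR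
    refine ⟨R, ⟨R, ⟨hR, hR'⟩, .refl, IsSpanning.not_isPendant hsp hS⟩, ?_⟩
    rw [IsSpanning.krullDim_eq hsp hR', h]

/-- The type of the lattice of a strand system. -/
lemma isBlockOfType_iff (k h : ℕ) : IsBlockOfType S.Elem (n + 1) k h ↔
    (∀ a, ∃ i : S.ι, Essential i ∧ (S.tgt i = a ∨ S.src i = a)) ∧
    Fintype.card S.ι + #{b : Fin n | S.mult b.castSucc b.succ = 0} = n + k ∧
    n + #{b : Fin n | 2 ≤ S.mult b.castSucc b.succ} = h := by
  simp only [← isReducible_node_iff]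
  constructor
  · rintro ⟨-, -, h1, h2, h3⟩
    rw [ncard_redSet_eq_iff] at h1
    rw [nullity_eq] at h2
    exact ⟨h1, by omega, (exists_isBasicBlockOf_krullDim_eq_iff h1 h).1 h3⟩
  · rintro ⟨h1, h2, h3⟩
    exact ⟨isBlock h1, isRCLattice, ncard_redSet_eq_iff.2 h1, by rw [nullity_eq]; omega,
      (exists_isBasicBlockOf_krullDim_eq_iff h1 h).2 h3⟩

end Elem
end StrandSystem

/-! ### Transport along order isomorphisms -/

section OrderIso

variable {P Q : Type*} [PartialOrder P] [PartialOrder Q]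

/-- An order isomorphism restricts to an order isomorphism from a subset to its image. -/
def orderIsoImage (e : P ≃o Q) (R : Set P) : R ≃o e '' R where
  toEquiv := e.toEquiv.image R
  map_rel_iff' := by
    intro a b
    exact e.le_iff_le

lemma IsRetractible.map (e : P ≃o Q) {x : P} (h : IsRetractible x) : IsRetractible (e x) := by
  obtain ⟨y, z, h1, h2, h3⟩ := h
  refine ⟨e y, e z, fun w => ?_, fun w => ?_, fun w => ?_⟩ <;>
    obtain ⟨w, rfl⟩ := e.surjective w
  · simp [h1]
  · simp [h2]
  · simpa using h3 w

lemma IsPendant.map (e : P ≃o Q) {x : P} (h : IsPendant x) : IsPendant (e x) := by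
  obtain ⟨y, h1, h2⟩ := h
  refine ⟨e y, ?_, fun w => ?_⟩
  · simpa [SimpleGraph.hasse] using h1
  · obtain ⟨w, rfl⟩ := e.surjective w
    intro hw
    rw [h2 w (by simpa [SimpleGraph.hasse] using hw)]

lemma RetractStep.map (e : P ≃o Q) {R T : Set P} (h : RetractStep R T) :
    RetractStep (e '' R) (e '' T) := by
  obtain ⟨x, hx, rfl⟩ := h
  refine ⟨orderIsoImage e R x, hx.map _, ?_⟩
  rw [Set.image_sdiff e.injective, Set.image_singleton]
  rfl

lemma PendantStep.map (e : P ≃o Q) {R T : Set P} (h : PendantStep R T) :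
    PendantStep (e '' R) (e '' T) := by
  obtain ⟨x, hx, rfl⟩ := h
  refine ⟨orderIsoImage e R x, hx.map _, ?_⟩
  rw [Set.image_sdiff e.injective, Set.image_singleton]
  rfl

lemma IsBasicBlockOf.map (e : P ≃o Q) {B : Set P} (h : IsBasicBlockOf B) :
    IsBasicBlockOf (e '' B) := by
  obtain ⟨R, ⟨h1, h2⟩, h3, h4⟩ := h
  refine ⟨e '' R, ⟨?_, fun x hx => ?_⟩, ?_, fun x hx => ?_⟩
  · have := Relation.ReflTransGen.lift (p := RetractStep) (fun T => e '' T)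
      (fun _ _ h => RetractStep.map e h) _ _ h1
    simpa [Function.onFun, e.surjective.range_eq] using this
  · exact h2 _ (hx.map (orderIsoImage e R).symm)
  · exact Relation.ReflTransGen.lift (p := PendantStep) (fun T => e '' T)
      (fun _ _ h => PendantStep.map e h) _ _ h3
  · exact h4 _ (hx.map (orderIsoImage e B).symm)

lemma nullity_congr (e : P ≃o Q) : nullity P = nullity Q := by
  have h1 : Nat.card {p : P × P // p.1 ⋖ p.2} = Nat.card {p : Q × Q // p.1 ⋖ p.2} :=
    Nat.card_congr ((Equiv.prodCongr e.toEquiv e.toEquiv).subtypeEquiv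
      fun p => (apply_covBy_apply_iff e).symm)
  let f : SimpleGraph.hasse P ≃g SimpleGraph.hasse Q :=
    ⟨e.toEquiv, by intro a b; simp [SimpleGraph.hasse]⟩
  rw [nullity, nullity, ncard_edgeSet_hasse, ncard_edgeSet_hasse, h1, Nat.card_congr e.toEquiv,
    Nat.card_congr f.connectedComponentEquiv]

end OrderIso

section LatticeIso

variable {α β : Type*} [Lattice α] [Lattice β]

lemma IsReducible.map (e : α ≃o β) {x : α} (h : IsReducible x) : IsReducible (e x) := by
  rcases h with ⟨y, z, hy, hz, rfl⟩ | ⟨y, z, hy, hz, rfl⟩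
  · exact .inl ⟨e y, e z, by simpa using hy, by simpa using hz, (e.map_sup y z).symm⟩
  · exact .inr ⟨e y, e z, by simpa using hy, by simpa using hz, (e.map_inf y z).symm⟩

lemma isReducible_map_iff (e : α ≃o β) {x : α} : IsReducible (e x) ↔ IsReducible x :=
  ⟨fun h => by simpa using h.map e.symm, fun h => h.map e⟩

lemma redSet_eq_image (e : α ≃o β) : redSet β = e '' redSet α := by
  ext x
  obtain ⟨x, rfl⟩ := e.surjective x
  rw [e.injective.mem_set_image]
  exact isReducible_map_iff e

lemma IsBlockOfType.map (e : α ≃o β) {r k h : ℕ} (H : IsBlockOfType α r k h) :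
    IsBlockOfType β r k h where
  isBlock := by
    obtain ⟨⟨x, hx, hx'⟩, ⟨y, hy, hy'⟩⟩ := H.isBlock
    exact ⟨⟨e x, fun z => e.le_symm_apply.1 (hx _), hx'.map e⟩,
      ⟨e y, fun z => e.symm_apply_le.1 (hy _), hy'.map e⟩⟩
  isRC := by
    rw [IsRCLattice, redSet_eq_image e]
    rintro _ ⟨x, hx, rfl⟩ _ ⟨y, hy, rfl⟩ hne
    simpa using H.isRC hx hy (fun h => hne (congrArg e h))
  ncard_red := by
    rw [redSet_eq_image e, Set.ncard_image_of_injective _ e.injective, H.ncard_red]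
  nullity_eq := by rw [← nullity_congr e, H.nullity_eq]
  height_eq := by
    obtain ⟨B, hB, h⟩ := H.height_eq
    exact ⟨e '' B, hB.map e, by rw [← h, Order.krullDim_eq_of_orderIso (orderIsoImage e B)]⟩

end LatticeIso

/-! ### Every block comes from a strand system -/

lemma exists_orderIso_fin {P : Type*} [PartialOrder P] [Finite P] (h : ∀ x y : P, x ≤ y ∨ y ≤ x)
    {m : ℕ} (hm : Nat.card P = m) : Nonempty (P ≃o Fin m) := by
  classical
  let _ : LinearOrder P :=
    { (inferInstance : PartialOrder P) with
      le_total := h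
      toDecidableLE := Classical.decRel _ }
  have := Fintype.ofFinite P
  rw [Nat.card_eq_fintype_card] at hm
  exact ⟨(Fintype.orderIsoFinOfCardEq P hm).symm⟩

/-- A lattice whose reducible elements form a chain indexed by `Fin (n + 1)`, with the nearest
reducible elements below and above each element. -/
structure ReducibleChain (α : Type*) [Lattice α] (n : ℕ) where
  /-- The reducible elements. -/
  red : Fin (n + 1) → α
  /-- The greatest reducible element below a given one. -/
  lo : α → Fin (n + 1)
  /-- The least reducible element above a given one. -/
  hi : α → Fin (n + 1)
  red_le_red_iff : ∀ {a b}, red a ≤ red b ↔ a ≤ b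
  isReducible_iff : ∀ {x}, IsReducible x ↔ ∃ a, red a = x
  red_le_iff : ∀ {a x}, red a ≤ x ↔ a ≤ lo x
  le_red_iff : ∀ {a x}, x ≤ red a ↔ hi x ≤ a

lemma IsBlock.exists_reducibleChain {α : Type*} [Lattice α] [Finite α] {n : ℕ} (h1 : IsBlock α)
    (h2 : IsRCLattice α) (h3 : (redSet α).ncard = n + 1) : Nonempty (ReducibleChain α n) := by
  classical
  obtain ⟨e⟩ := exists_orderIso_fin (P := redSet α)
    (fun x y => by
      by_cases hxy : x = y
      · exact .inl hxy.le
      · exact h2 x.2 y.2 fun h => hxy (Subtype.ext h)) h3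
  have hred : ∀ {x : α}, IsReducible x ↔ ∃ a, (e.symm a : α) = x := by
    intro x
    constructor
    · intro hx
      exact ⟨e ⟨x, hx⟩, by simp⟩
    · rintro ⟨a, rfl⟩
      exact (e.symm a).2
  have hmono : ∀ {a b}, (e.symm a : α) ≤ e.symm b ↔ a ≤ b := by
    intro a b
    rw [Subtype.coe_le_coe, e.symm.le_iff_le]
  obtain ⟨⟨b, hb, hb'⟩, ⟨t, ht, ht'⟩⟩ := h1
  obtain ⟨b', hb'⟩ := hred.1 hb'
  obtain ⟨t', ht'⟩ := hred.1 ht'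
  have hlo : ∀ x : α, ∃ c, ∀ a, (e.symm a : α) ≤ x ↔ a ≤ c := by
    intro x
    -- The least element of a block is reducible, so some reducible element lies below `x`; the dual
    -- fact is used for `hhi`.
    have hne : (univ.filter fun a => (e.symm a : α) ≤ x).Nonempty :=
      ⟨b', by simpa [hb'] using hb x⟩
    refine ⟨max' _ hne, fun a => ⟨fun h => le_max' _ a (mem_filter.2 ⟨mem_univ _, h⟩), fun h => ?_⟩⟩
    · have := max'_mem _ hne
      rw [mem_filter] at this
      exact (hmono.2 h).trans this.2
  have hhi : ∀ x : α, ∃ c, ∀ a, x ≤ (e.symm a : α) ↔ c ≤ a := by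
    intro x
    have hne : (univ.filter fun a => x ≤ (e.symm a : α)).Nonempty :=
      ⟨t', by simpa [ht'] using ht x⟩
    refine ⟨min' _ hne, fun a => ⟨fun h => min'_le _ a (mem_filter.2 ⟨mem_univ _, h⟩), fun h => ?_⟩⟩
    · have := min'_mem _ hne
      rw [mem_filter] at this
      exact this.2.trans (hmono.2 h)
  choose lo hlo using hlo
  choose hi hhi using hhi
  exact ⟨⟨fun a => e.symm a, lo, hi, hmono, hred, fun {a x} => hlo x a, fun {a x} => hhi x a⟩⟩

namespace ReducibleChain

variable {α : Type} [Lattice α] {n : ℕ} (C : ReducibleChain α n)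

lemma lo_mono {x y : α} (h : x ≤ y) : C.lo x ≤ C.lo y :=
  C.red_le_iff.1 ((C.red_le_iff.2 le_rfl).trans h)

lemma hi_mono {x y : α} (h : x ≤ y) : C.hi x ≤ C.hi y :=
  C.le_red_iff.1 (h.trans (C.le_red_iff.2 le_rfl))

lemma le_of_hi_le_lo {x y : α} (h : C.hi x ≤ C.lo y) : x ≤ y :=
  (C.le_red_iff.2 h).trans (C.red_le_iff.2 le_rfl)

lemma exists_red_eq_inf {x y : α} (h1 : ¬ x ≤ y) (h2 : ¬ y ≤ x) : ∃ a, C.red a = x ⊓ y :=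
  C.isReducible_iff.1 (.inr ⟨x, y, fun h => h1 (inf_eq_left.1 h.symm),
    fun h => h2 (inf_eq_right.1 h.symm), rfl⟩)

lemma exists_red_eq_sup {x y : α} (h1 : ¬ x ≤ y) (h2 : ¬ y ≤ x) : ∃ a, C.red a = x ⊔ y :=
  C.isReducible_iff.1 (.inl ⟨x, y, fun h => h2 (sup_eq_left.1 h.symm),
    fun h => h1 (sup_eq_right.1 h.symm), rfl⟩)

/-- Were `y` and `z` incomparable, their meet would be a reducible element between `x` and `y`. -/
lemma comparable_of_ge {x y z : α} (hy : x ≤ y) (hz : x ≤ z) (h : ¬ C.hi x ≤ C.lo y) :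
    y ≤ z ∨ z ≤ y := by
  by_contra! hne
  obtain ⟨a, ha⟩ := C.exists_red_eq_inf hne.1 hne.2
  have h1 := C.le_red_iff.1 (ha.symm ▸ le_inf hy hz)
  exact h (h1.trans (C.red_le_iff.1 (ha ▸ inf_le_left)))

lemma comparable_of_le {x y z : α} (hy : y ≤ x) (hz : z ≤ x) (h : ¬ C.hi y ≤ C.lo x) :
    y ≤ z ∨ z ≤ y := by
  by_contra! hne
  obtain ⟨a, ha⟩ := C.exists_red_eq_sup hne.1 hne.2
  have h1 := C.red_le_iff.1 (ha.symm ▸ sup_le hy hz)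
  exact h ((C.le_red_iff.1 (ha ▸ le_sup_left)).trans h1)

lemma hi_eq {x y : α} (h : x ≤ y) (hxy : ¬ C.hi x ≤ C.lo y) : C.hi x = C.hi y := by
  refine (C.hi_mono h).antisymm (C.le_red_iff.1 ?_)
  rcases C.comparable_of_ge h (C.le_red_iff.2 le_rfl) hxy with h' | h'
  · exact h'
  · exact absurd (C.red_le_iff.1 h') hxy

lemma lo_eq {x y : α} (h : x ≤ y) (hxy : ¬ C.hi x ≤ C.lo y) : C.lo x = C.lo y := by
  refine (C.lo_mono h).antisymm (C.red_le_iff.1 ?_)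
  rcases C.comparable_of_le h (C.red_le_iff.2 le_rfl) hxy with h' | h'
  · exact absurd (C.le_red_iff.1 h') hxy
  · exact h'

/-- Comparability without a reducible element in between. -/
def Rel (x y : α) : Prop := (x ≤ y ∨ y ≤ x) ∧ ¬ C.hi x ≤ C.lo y ∧ ¬ C.hi y ≤ C.lo x

variable {C}

lemma Rel.symm {x y : α} (h : C.Rel x y) : C.Rel y x := ⟨h.1.symm, h.2.2, h.2.1⟩

lemma Rel.lo_eq {x y : α} (h : C.Rel x y) : C.lo x = C.lo y := by
  rcases h with ⟨h1 | h1, h2, h3⟩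
  · exact C.lo_eq h1 h2
  · exact (C.lo_eq h1 h3).symm

lemma Rel.hi_eq {x y : α} (h : C.Rel x y) : C.hi x = C.hi y := by
  rcases h with ⟨h1 | h1, h2, h3⟩
  · exact C.hi_eq h1 h2
  · exact (C.hi_eq h1 h3).symm

/-- Related elements have the same nearest nodes, so the separation conditions carry over.
Comparability is clear along a chain; when both relations point up to or down from `y`, it follows
since no node intervenes. -/
lemma Rel.trans {x y z : α} (h : C.Rel x y) (h' : C.Rel y z) : C.Rel x z := by
  refine ⟨?_, by rw [← h'.lo_eq]; exact h.2.1, by rw [← h'.hi_eq]; exact h.2.2⟩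
  rcases h with ⟨h1 | h1, h2, h3⟩ <;> rcases h' with ⟨h4 | h4, h5, h6⟩
  · exact .inl (h1.trans h4)
  · exact C.comparable_of_le h1 h4 h2
  · exact C.comparable_of_ge h1 h4 h3
  · exact .inr (h4.trans h1)

lemma not_hi_le_lo {x : α} (hx : ¬ IsReducible x) : ¬ C.hi x ≤ C.lo x := fun h =>
  hx (C.isReducible_iff.2 ⟨C.lo x, (C.red_le_iff.2 le_rfl).antisymm (C.le_red_iff.2 h)⟩)

variable (C)

/-- Being on the same strand. -/
def strandSetoid : Setoid {x : α // ¬ IsReducible x} where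
  r x y := C.Rel x y
  iseqv := ⟨fun x => ⟨.inl le_rfl, not_hi_le_lo x.2, not_hi_le_lo x.2⟩, Rel.symm, Rel.trans⟩

variable [Finite α]

/-- The strand system of a lattice. -/
noncomputable def strandSystem : StrandSystem n where
  ι := Quotient C.strandSetoid
  fintype := Fintype.ofFinite _
  src := Quotient.lift (fun x => C.lo x) fun _ _ h => Rel.lo_eq h
  tgt := Quotient.lift (fun x => C.hi x) fun _ _ h => Rel.hi_eq h
  len q := Nat.card {x // (Quotient.mk C.strandSetoid x) = q}
  src_lt_tgt q := by
    induction q using Quotient.ind with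
    | _ x => exact not_le.1 (not_hi_le_lo (C := C) x.2)
  len_pos q := by
    induction q using Quotient.ind with
    | _ x => exact Nat.card_pos_iff.2 ⟨⟨x, rfl⟩, inferInstance⟩

lemma exists_orderIso_strand (q : C.strandSystem.ι) :
    Nonempty ({x // (Quotient.mk C.strandSetoid x) = q} ≃o Fin (C.strandSystem.len q)) :=
  exists_orderIso_fin (fun x y =>
    (Quotient.exact (s := C.strandSetoid) (x.2.trans y.2.symm) : C.Rel _ _).1) rfl

theorem nonempty_orderIso : Nonempty (C.strandSystem.Elem ≃o α) := by
  have e := fun q => Classical.choice (C.exists_orderIso_strand q)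
  let f : C.strandSystem.Elem → α
    | .node a => C.red a
    | .bead q t h => ((e q).symm ⟨t, h⟩).1.1
  have hsrc : ∀ (q : C.strandSystem.ι) (x : {x // (Quotient.mk C.strandSetoid x) = q}),
      C.strandSystem.src q = C.lo x.1.1 := by
    rintro _ ⟨x, rfl⟩
    rfl
  have htgt : ∀ (q : C.strandSystem.ι) (x : {x // (Quotient.mk C.strandSetoid x) = q}),
      C.strandSystem.tgt q = C.hi x.1.1 := by
    rintro _ ⟨x, rfl⟩
    rfl
  have hf : ∀ x y, f x ≤ f y ↔ x ≤ y := by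
    rintro (a | ⟨q, t, ht⟩) (b | ⟨p, s, hs⟩)
    · exact C.red_le_red_iff
    · rw [StrandSystem.Elem.node_le_bead, hsrc p ((e p).symm ⟨s, hs⟩)]
      exact C.red_le_iff
    · rw [StrandSystem.Elem.bead_le_node, htgt q ((e q).symm ⟨t, ht⟩)]
      exact C.le_red_iff
    · rw [StrandSystem.Elem.bead_le_bead, htgt q ((e q).symm ⟨t, ht⟩),
        hsrc p ((e p).symm ⟨s, hs⟩)]
      change ((e q).symm ⟨t, ht⟩).1.1 ≤ ((e p).symm ⟨s, hs⟩).1.1 ↔ _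
      constructor
      · intro h
        by_cases h1 : C.hi ((e q).symm ⟨t, ht⟩).1.1 ≤ C.lo ((e p).symm ⟨s, hs⟩).1.1
        · exact .inl h1
        · have hrel : C.Rel ((e q).symm ⟨t, ht⟩).1.1 ((e p).symm ⟨s, hs⟩).1.1 :=
            ⟨.inl h, h1, fun h2 => not_hi_le_lo (C := C) ((e q).symm ⟨t, ht⟩).1.2
              ((C.hi_mono h).trans h2)⟩
          obtain rfl : q = p := ((e q).symm ⟨t, ht⟩).2.symm.trans
            ((Quotient.sound (s := C.strandSetoid) hrel).trans ((e p).symm ⟨s, hs⟩).2)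
          refine .inr ⟨rfl, ?_⟩
          have : (e q).symm ⟨t, ht⟩ ≤ (e q).symm ⟨s, hs⟩ := h
          simpa using this
      · rintro (h | ⟨rfl, h⟩)
        · exact C.le_of_hi_le_lo h
        · have : (e q).symm ⟨t, ht⟩ ≤ (e q).symm ⟨s, hs⟩ := by simpa using h
          exact this
  refine ⟨RelIso.ofSurjective (OrderEmbedding.ofMapLEIff f hf) fun x => ?_⟩
  by_cases hx : IsReducible x
  · obtain ⟨a, rfl⟩ := C.isReducible_iff.1 hx
    exact ⟨.node a, rfl⟩
  · let q : C.strandSystem.ι := Quotient.mk C.strandSetoid ⟨x, hx⟩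
    let y : {x // (Quotient.mk C.strandSetoid x) = q} := ⟨⟨x, hx⟩, rfl⟩
    refine ⟨.bead q (e q y) (e q y).2, ?_⟩
    change ((e q).symm (e q y)).1.1 = x
    rw [OrderIso.symm_apply_apply]

end ReducibleChain

/-! ### The multiset of strands as a complete invariant -/

namespace StrandSystem

variable {n : ℕ}

/-- The data of a strand: its ends and its number of beads. -/
def triple (S : StrandSystem n) (i : S.ι) : Fin (n + 1) × Fin (n + 1) × ℕ :=
  (S.src i, S.tgt i, S.len i)

/-- The multiset of the strands. -/
def code (S : StrandSystem n) : Multiset (Fin (n + 1) × Fin (n + 1) × ℕ) :=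
  (univ : Finset S.ι).val.map S.triple

/-- The strand system with given strands. -/
def ofCode (T : Multiset (Fin (n + 1) × Fin (n + 1) × ℕ))
    (hT : ∀ t ∈ T, t.1 < t.2.1 ∧ 0 < t.2.2) : StrandSystem n where
  ι := T.ToType
  src i := i.1.1
  tgt i := i.1.2.1
  len i := i.1.2.2
  src_lt_tgt _ := (hT _ Multiset.coe_mem).1
  len_pos _ := (hT _ Multiset.coe_mem).2

lemma code_ofCode (T : Multiset (Fin (n + 1) × Fin (n + 1) × ℕ))
    (hT : ∀ t ∈ T, t.1 < t.2.1 ∧ 0 < t.2.2) : (ofCode T hT).code = T := by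
  have := Multiset.map_univ T id
  rw [Multiset.map_id] at this
  exact this

lemma code_valid (S : StrandSystem n) : ∀ t ∈ S.code, t.1 < t.2.1 ∧ 0 < t.2.2 := by
  intro t ht
  obtain ⟨i, -, rfl⟩ := Multiset.mem_map.1 ht
  exact ⟨S.src_lt_tgt i, S.len_pos i⟩

lemma card_code (S : StrandSystem n) : S.code.card = Fintype.card S.ι := by
  rw [code, Multiset.card_map]
  rfl

lemma sum_code (S : StrandSystem n) : (S.code.map (·.2.2)).sum = ∑ i, S.len i := by
  rw [code, Multiset.map_map]
  rfl

/-- The number of strands with given ends. -/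
def codeMult (T : Multiset (Fin (n + 1) × Fin (n + 1) × ℕ)) (a b : Fin (n + 1)) : ℕ :=
  T.countP fun t => t.1 = a ∧ t.2.1 = b

lemma codeMult_code (S : StrandSystem n) (a b : Fin (n + 1)) :
    codeMult S.code a b = S.mult a b := by
  rw [codeMult, code, Multiset.countP_map]
  rfl

lemma one_le_mult_iff {S : StrandSystem n} {a b : Fin (n + 1)} : 1 ≤ S.mult a b ↔
    ∃ i : S.ι, S.src i = a ∧ S.tgt i = b := by
  rw [mult, Nat.one_le_iff_ne_zero, Finset.card_ne_zero, Finset.filter_nonempty_iff]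
  simp

lemma exists_essential_iff {S : StrandSystem n} {a : Fin (n + 1)} :
    (∃ i : S.ι, Essential i ∧ (S.tgt i = a ∨ S.src i = a)) ↔
    ∃ b c : Fin (n + 1), (c = a ∨ b = a) ∧
      (((b : ℕ) + 1 < c ∧ 1 ≤ S.mult b c) ∨ 2 ≤ S.mult b c) := by
  constructor
  · rintro ⟨i, hi, ha⟩
    refine ⟨S.src i, S.tgt i, ha, ?_⟩
    rcases hi with hi | ⟨k, hk, hk1, hk2⟩
    · exact .inl ⟨hi, one_le_mult_iff.2 ⟨i, rfl, rfl⟩⟩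
    · exact .inr (two_le_mult_iff.2 ⟨i, k, hk.symm, ⟨rfl, rfl⟩, hk1, hk2⟩)
  · rintro ⟨b, c, ha, ⟨h, hm⟩ | hm⟩
    · obtain ⟨i, rfl, rfl⟩ := one_le_mult_iff.1 hm
      exact ⟨i, .inl h, ha⟩
    · obtain ⟨i, k, hik, ⟨rfl, rfl⟩, h1, h2⟩ := two_le_mult_iff.1 hm
      exact ⟨i, .inr ⟨k, hik.symm, h1, h2⟩, ha⟩

/-- The codes of the blocks of a given type. -/
structure IsCode (n j k h : ℕ) (T : Multiset (Fin (n + 1) × Fin (n + 1) × ℕ)) : Prop where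
  valid : ∀ t ∈ T, t.1 < t.2.1 ∧ 0 < t.2.2
  size : n + 1 + (T.map (·.2.2)).sum = j
  red : ∀ a, ∃ b c : Fin (n + 1), (c = a ∨ b = a) ∧
      (((b : ℕ) + 1 < c ∧ 1 ≤ codeMult T b c) ∨ 2 ≤ codeMult T b c)
  nullity : T.card + #{b : Fin n | codeMult T b.castSucc b.succ = 0} = n + k
  height : n + #{b : Fin n | 2 ≤ codeMult T b.castSucc b.succ} = h

lemma isCode_code_iff {S : StrandSystem n} {j k h : ℕ} : IsCode n j k h S.code ↔
    Nat.card S.Elem = j ∧ IsBlockOfType S.Elem (n + 1) k h := by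
  rw [Elem.isBlockOfType_iff, Elem.card_elem, ← sum_code]
  simp only [exists_essential_iff, ← card_code, ← codeMult_code]
  exact ⟨fun ⟨_, h2, h3, h4, h5⟩ => ⟨h2, h3, h4, h5⟩,
    fun ⟨h2, h3, h4, h5⟩ => ⟨S.code_valid, h2, h3, h4, h5⟩⟩

/-- Equal multisets have equally many strands with each triple; matching these fibres gives a
bijection of strands that preserves ends and sizes. -/
lemma nonempty_orderIso_of_code_eq {S S' : StrandSystem n} (h : S.code = S'.code) :
    Nonempty (S.Elem ≃o S'.Elem) := by
  classical
  have hfib : ∀ c, Nonempty ({i // S.triple i = c} ≃ {i // S'.triple i = c}) := by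
    intro c
    have hc : S.code.countP (· = c) = S'.code.countP (· = c) := by rw [h]
    rw [code, code, Multiset.countP_map, Multiset.countP_map] at hc
    refine ⟨Fintype.equivOfCardEq ?_⟩
    rw [Fintype.card_subtype, Fintype.card_subtype]
    exact hc
  let σ : S.ι ≃ S'.ι := Equiv.ofFiberEquiv fun c => Classical.choice (hfib c)
  have hσ : ∀ i, S'.triple (σ i) = S.triple i := fun i => Equiv.ofFiberEquiv_map _ i
  have hsrc : ∀ i, S'.src (σ i) = S.src i := fun i => congrArg Prod.fst (hσ i)
  have htgt : ∀ i, S'.tgt (σ i) = S.tgt i := fun i => congrArg (fun t => t.2.1) (hσ i)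
  have hlen : ∀ i, S'.len (σ i) = S.len i := fun i => congrArg (fun t => t.2.2) (hσ i)
  let f : S.Elem → S'.Elem
    | .node a => .node a
    | .bead i t ht => .bead (σ i) t ((hlen i).symm ▸ ht)
  refine ⟨RelIso.ofSurjective (OrderEmbedding.ofMapLEIff f ?_) ?_⟩
  · rintro (a | ⟨i, t, ht⟩) (b | ⟨k, s, hs⟩) <;> simp [f, hsrc, htgt, -Elem.le_node_iff,
      -Elem.node_le_iff]
  · rintro (a | ⟨i, t, ht⟩)
    · exact ⟨.node a, rfl⟩
    · refine ⟨.bead (σ.symm i) t (by rw [← hlen, Equiv.apply_symm_apply]; exact ht), ?_⟩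
      change Elem.bead (σ (σ.symm i)) t _ = _
      simp

namespace Elem

variable {S S' : StrandSystem n}

/-- Reducible elements go to reducible elements, so the nodes undergo a strictly increasing self-map
of `Fin (n + 1)`, which is the identity. -/
lemma exists_node_of_orderIso (hS : ∀ a, IsReducible (node a : S.Elem)) (e : S.Elem ≃o S'.Elem)
    (a : Fin (n + 1)) : e (node a) = node a := by
  have h : ∀ a, ∃ b, e (node a) = node b := by
    intro a
    obtain ⟨b, hb⟩ := redSet_subset (show e (node a) ∈ redSet S'.Elem from (hS a).map e)
    exact ⟨b, hb.symm⟩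
  choose f hf using h
  have hmono : StrictMono f := by
    intro a b hab
    rw [← node_lt_node (S := S'), ← hf, ← hf, e.lt_iff_lt, node_lt_node]
    exact hab
  rw [hf, le_antisymm hmono.apply_le hmono.le_apply]

lemma exists_strand_of_orderIso (hS : ∀ a, IsReducible (node a : S.Elem))
    (hS' : ∀ a, IsReducible (node a : S'.Elem)) (e : S.Elem ≃o S'.Elem) (i : S.ι) :
    ∃ k, S'.src k = S.src i ∧ S'.tgt k = S.tgt i ∧ S.len i ≤ S'.len k ∧
      ∀ t h, ∃ s h', e (bead i t h) = bead k s h' := by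
  have hn := exists_node_of_orderIso hS e
  have hb : ∀ t h, ∃ k s h', e (bead i t h) = bead k s h' ∧ S'.src k = S.src i ∧
      S'.tgt k = S.tgt i := by
    intro t h
    rcases he : e (bead i t h) with a | ⟨k, s, hs⟩
    · exact absurd ((isReducible_map_iff e).1 (he ▸ hS' a)) not_isReducible_bead
    · refine ⟨k, s, hs, rfl, ?_, ?_⟩
      · refine eq_of_forall_le_iff fun c => ?_
        rw [← node_le_bead (h := hs), ← he, ← hn, e.le_iff_le, node_le_bead]
      · refine eq_of_forall_ge_iff fun c => ?_
        rw [← bead_le_node (h := hs), ← he, ← hn, e.le_iff_le, bead_le_node]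
  obtain ⟨k, s, hs, he, h1, h2⟩ := hb 0 (S.len_pos i)
  have key : ∀ t h, ∃ s h', e (bead i t h) = bead k s h' := by
    intro t h
    obtain ⟨k', s', hs', he', h1', h2'⟩ := hb t h
    -- Comparable beads on different strands are separated by a node, which is impossible here as
    -- both images have the ends of `i`.
    have hle : e (bead i 0 (S.len_pos i)) ≤ e (bead i t h) := by
      rw [e.le_iff_le]
      simp
    rw [he, he', bead_le_bead] at hle
    rcases hle with hle | ⟨rfl, -⟩
    · rw [h2, h1'] at hle
      exact absurd (S.src_lt_tgt i) hle.not_gt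
    · exact ⟨s', hs', he'⟩
  refine ⟨k, h1, h2, ?_, key⟩
  choose g hg hge using key
  have hinj : Function.Injective fun t : Fin (S.len i) => (⟨g t t.2, hg t t.2⟩ : Fin (S'.len k)) := by
    intro t t' h
    have h' : e (bead i t t.2) = e (bead i t' t'.2) := by
      rw [hge, hge]
      simpa using h
    simpa [Fin.ext_iff] using h'
  simpa using Fintype.card_le_of_injective _ hinj

lemma code_eq_of_orderIso (hS : ∀ a, IsReducible (node a : S.Elem))
    (hS' : ∀ a, IsReducible (node a : S'.Elem)) (e : S.Elem ≃o S'.Elem) : S.code = S'.code := by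
  choose σ h1 h2 h3 h4 using exists_strand_of_orderIso hS hS' e
  choose τ g1 g2 g3 g4 using exists_strand_of_orderIso hS' hS e.symm
  have hl : ∀ i, τ (σ i) = i := by
    intro i
    obtain ⟨s, hs, h⟩ := h4 i 0 (S.len_pos i)
    obtain ⟨t, ht, h'⟩ := g4 (σ i) s hs
    rw [← h, e.symm_apply_apply] at h'
    simp only [bead.injEq] at h'
    exact h'.1.symm
  have hr : ∀ k, σ (τ k) = k := by
    intro k
    obtain ⟨s, hs, h⟩ := g4 k 0 (S'.len_pos k)
    obtain ⟨t, ht, h'⟩ := h4 (τ k) s hs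
    rw [← h, e.apply_symm_apply] at h'
    simp only [bead.injEq] at h'
    exact h'.1.symm
  let ε : S.ι ≃ S'.ι := ⟨σ, τ, hl, hr⟩
  have ht : S.triple = S'.triple ∘ ε := by
    funext i
    have := g3 (σ i)
    rw [hl] at this
    exact Prod.ext (h1 i).symm (Prod.ext (h2 i).symm (le_antisymm (h3 i) this))
  rw [code, code, ← Finset.map_univ_equiv ε, Finset.map_val, Multiset.map_map, ht]
  rfl

end Elem
end StrandSystem

lemma FinLattice.exists_orderIso {α : Type} [Lattice α] [Finite α] {j : ℕ} (h : Nat.card α = j) :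
    ∃ L : FinLattice j, Nonempty (L.Carrier ≃o α) := by
  let e : Fin j ≃ α := (Finite.equivFinOfCardEq h).symm
  let s : Lattice (Fin j) :=
    { PartialOrder.lift e e.injective with
      sup := fun x y => e.symm (e x ⊔ e y)
      inf := fun x y => e.symm (e x ⊓ e y)
      le_sup_left := fun x y => show e x ≤ e (e.symm _) by simp
      le_sup_right := fun x y => show e y ≤ e (e.symm _) by simp
      sup_le := fun x y z (hx : e x ≤ e z) (hy : e y ≤ e z) =>
        show e (e.symm _) ≤ e z by simp [hx, hy]
      inf_le_left := fun x y => show e (e.symm _) ≤ e x by simp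
      inf_le_right := fun x y => show e (e.symm _) ≤ e y by simp
      le_inf := fun x y z (hx : e x ≤ e y) (hy : e x ≤ e z) =>
        show e x ≤ e (e.symm _) by simp [hx, hy] }
  exact ⟨⟨s⟩, ⟨⟨e, Iff.rfl⟩⟩⟩

open StrandSystem in
/-- The number of isomorphism classes of blocks is the number of codes. -/
theorem card_blockClass (n j k h : ℕ) :
    Nat.card (BlockClass j (n + 1) k h) = Nat.card {T // IsCode n j k h T} := by
  have key : ∀ T : {T // IsCode n j k h T}, ∃ L : FinLattice j,
      IsBlockOfType L.Carrier (n + 1) k h ∧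
      Nonempty (L.Carrier ≃o (ofCode T.1 T.2.valid).Elem) := by
    rintro ⟨T, hT⟩
    have hc := isCode_code_iff.1 ((code_ofCode T hT.valid).symm ▸ hT)
    obtain ⟨L, ⟨e⟩⟩ := FinLattice.exists_orderIso hc.1
    exact ⟨L, hc.2.map e.symm, ⟨e⟩⟩
  choose L hL e using key
  symm
  refine Nat.card_eq_of_bijective
    (fun T => (Quotient.mk (blockSetoid j (n + 1) k h) ⟨L T, hL T⟩ :
      BlockClass j (n + 1) k h)) ⟨?_, ?_⟩
  · intro T T' hTT
    obtain ⟨g⟩ : Nonempty ((L T).Carrier ≃o (L T').Carrier) := Quotient.exact hTT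
    obtain ⟨f⟩ := e T
    obtain ⟨f'⟩ := e T'
    have h1 := Elem.code_eq_of_orderIso (Elem.ncard_redSet_eq_iff.1 ((hL T).map f).ncard_red)
      (Elem.ncard_redSet_eq_iff.1 ((hL T').map f').ncard_red) (f.symm.trans (g.trans f'))
    rw [code_ofCode, code_ofCode] at h1
    exact Subtype.ext h1
  · intro c
    obtain ⟨⟨M, hM⟩, rfl⟩ := Quotient.exists_rep c
    have : Finite M.Carrier := inferInstanceAs (Finite (Fin j))
    obtain ⟨C⟩ := IsBlock.exists_reducibleChain hM.isBlock hM.isRC hM.ncard_red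
    obtain ⟨g⟩ := C.nonempty_orderIso
    have hcard : Nat.card C.strandSystem.Elem = j := by
      rw [Nat.card_congr g.toEquiv]
      exact Nat.card_fin j
    have hT : IsCode n j k h C.strandSystem.code := isCode_code_iff.2 ⟨hcard, hM.map g.symm⟩
    obtain ⟨f⟩ := e ⟨_, hT⟩
    obtain ⟨g'⟩ := nonempty_orderIso_of_code_eq (code_ofCode _ hT.valid)
    exact ⟨⟨_, hT⟩, Quotient.sound ⟨f.trans (g'.trans g)⟩⟩

/-! ### The four sums as sums over one index set -/

/-- The sizes of two pairs of beaded strands, of a single strand, and of two optional strands in a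
block on `j` elements. -/
def sizeSet (j : ℕ) : Finset (ℕ × ℕ × ℕ × ℕ × ℕ) :=
  (range j ×ˢ range j ×ˢ range j ×ˢ range j ×ˢ range j).filter fun w =>
    2 ≤ w.1 ∧ 2 ≤ w.2.1 ∧ 1 ≤ w.2.2.1 ∧ w.1 + w.2.1 + w.2.2.1 + w.2.2.2.1 + w.2.2.2.2 + 5 = j

lemma mem_sizeSet {j : ℕ} {w : ℕ × ℕ × ℕ × ℕ × ℕ} : w ∈ sizeSet j ↔
    2 ≤ w.1 ∧ 2 ≤ w.2.1 ∧ 1 ≤ w.2.2.1 ∧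
      w.1 + w.2.1 + w.2.2.1 + w.2.2.2.1 + w.2.2.2.2 + 5 = j := by
  simp only [sizeSet, mem_filter, mem_product, mem_range, and_iff_right_iff_imp]
  omega

section Reindex

variable {j : ℕ} (f : ℕ → ℕ → ℕ)

/-- The summation variables encode the five sizes linearly. The shift `s - 1` appears because `s`
starts at 1 while the optional strand may be absent. -/
lemma sum_first : ∑ u ∈ Icc 4 (j - 6), ∑ r ∈ Icc 0 (u - 4), ∑ l ∈ Icc 1 (j - u - 5),
    ∑ s ∈ Icc 1 (j - u - l - 4), f (u - r - 2) (j - u - l - s - 2) =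
    ∑ w ∈ sizeSet j, f w.1 w.2.1 := by
  simp only [sum_sigma']
  refine sum_bij' (fun x _ => (x.1 - x.2.1 - 2, j - x.1 - x.2.2.1 - x.2.2.2 - 2, x.2.2.1,
      x.2.1, x.2.2.2 - 1))
    (fun w _ => ⟨w.1 + w.2.2.2.1 + 2, w.2.2.2.1, w.2.2.1, w.2.2.2.2 + 1⟩) ?_ ?_ ?_ ?_ ?_
  · rintro ⟨u, r, l, s⟩ h
    simp only [mem_sigma, mem_Icc, mem_sizeSet] at h ⊢
    omega
  · rintro ⟨a, b, c, d, e⟩ h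
    simp only [mem_sigma, mem_Icc, mem_sizeSet] at h ⊢
    omega
  · rintro ⟨u, r, l, s⟩ h
    simp only [mem_sigma, mem_Icc] at h
    simp only [Sigma.mk.injEq, heq_eq_eq, true_and]
    omega
  · rintro ⟨a, b, c, d, e⟩ h
    simp only [mem_sizeSet] at h
    simp only [Prod.mk.injEq, true_and]
    omega
  · rintro ⟨u, r, l, s⟩ h
    rfl

lemma sum_second : ∑ p ∈ Icc 7 (j - 3), ∑ q ∈ Icc 1 (p - 6), ∑ l ∈ Icc 2 (p - q - 4),
    (l - 1) * f (p - q - l - 2) (j - p - 1) = ∑ w ∈ sizeSet j, f w.1 w.2.1 := by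
  -- The factor `l - 1` counts the ways to share `l - 1` beads between the long strand (at least
  -- one) and an optional strand (possibly none); it becomes a fourth summation.
  have h : ∀ l m, (l - 1) * m = ∑ _x ∈ Icc 1 (l - 1), m := by simp
  simp only [h, sum_sigma']
  refine sum_bij' (fun x _ => (x.1 - x.2.1 - x.2.2.1 - 2, j - x.1 - 1, x.2.2.2,
      x.2.2.1 - x.2.2.2 - 1, x.2.1 - 1))
    (fun w _ => ⟨j - w.2.1 - 1, w.2.2.2.2 + 1, w.2.2.1 + w.2.2.2.1 + 1, w.2.2.1⟩) ?_ ?_ ?_ ?_ ?_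
  · rintro ⟨u, r, l, s⟩ h
    simp only [mem_sigma, mem_Icc, mem_sizeSet] at h ⊢
    omega
  · rintro ⟨a, b, c, d, e⟩ h
    simp only [mem_sigma, mem_Icc, mem_sizeSet] at h ⊢
    omega
  · rintro ⟨u, r, l, s⟩ h
    simp only [mem_sigma, mem_Icc] at h
    simp only [Sigma.mk.injEq, heq_eq_eq, and_true]
    omega
  · rintro ⟨a, b, c, d, e⟩ h
    simp only [mem_sizeSet] at h
    simp only [Prod.mk.injEq, true_and]
    omega
  · rintro ⟨u, r, l, s⟩ h
    rfl

lemma sum_third : ∑ t ∈ Icc 1 (j - 9), ∑ k ∈ Icc 2 (j - t - 7), ∑ l ∈ Icc 4 (j - k - t - 3),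
    (k - 1) * f (l - 2) (j - k - t - l - 1) = ∑ w ∈ sizeSet j, f w.1 w.2.1 := by
  have h : ∀ l m, (l - 1) * m = ∑ _x ∈ Icc 1 (l - 1), m := by simp
  simp only [h, sum_sigma']
  refine sum_bij' (fun x _ => (x.2.2.1 - 2, j - x.2.1 - x.1 - x.2.2.1 - 1, x.2.2.2,
      x.2.1 - x.2.2.2 - 1, x.1 - 1))
    (fun w _ => ⟨w.2.2.2.2 + 1, w.2.2.1 + w.2.2.2.1 + 1, w.1 + 2, w.2.2.1⟩) ?_ ?_ ?_ ?_ ?_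
  · rintro ⟨u, r, l, s⟩ h
    simp only [mem_sigma, mem_Icc, mem_sizeSet] at h ⊢
    omega
  · rintro ⟨a, b, c, d, e⟩ h
    simp only [mem_sigma, mem_Icc, mem_sizeSet] at h ⊢
    omega
  · rintro ⟨u, r, l, s⟩ h
    simp only [mem_sigma, mem_Icc] at h
    simp only [Sigma.mk.injEq, heq_eq_eq, and_true]
    omega
  · rintro ⟨a, b, c, d, e⟩ h
    simp only [mem_sizeSet] at h
    simp only [Prod.mk.injEq, true_and]
    omega
  · rintro ⟨u, r, l, s⟩ h
    rfl

lemma sum_fourth : ∑ s ∈ Icc 1 (j - 9), ∑ t ∈ Icc 1 (j - s - 8), ∑ m ∈ Icc 0 (j - t - s - 8),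
    ∑ p ∈ Icc 4 (j - t - s - m - 4), f (p - 2) (j - t - s - m - p - 2) =
    ∑ w ∈ sizeSet j, f w.1 w.2.1 := by
  simp only [sum_sigma']
  refine sum_bij' (fun x _ => (x.2.2.2 - 2, j - x.2.1 - x.1 - x.2.2.1 - x.2.2.2 - 2, x.1,
      x.2.1 - 1, x.2.2.1))
    (fun w _ => ⟨w.2.2.1, w.2.2.2.1 + 1, w.2.2.2.2, w.1 + 2⟩) ?_ ?_ ?_ ?_ ?_
  · rintro ⟨u, r, l, s⟩ h
    simp only [mem_sigma, mem_Icc, mem_sizeSet] at h ⊢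
    omega
  · rintro ⟨a, b, c, d, e⟩ h
    simp only [mem_sigma, mem_Icc, mem_sizeSet] at h ⊢
    omega
  · rintro ⟨u, r, l, s⟩ h
    simp only [mem_sigma, mem_Icc] at h
    simp only [Sigma.mk.injEq, heq_eq_eq, true_and]
    omega
  · rintro ⟨a, b, c, d, e⟩ h
    simp only [mem_sizeSet] at h
    simp only [Prod.mk.injEq, true_and, and_true]
    omega
  · rintro ⟨u, r, l, s⟩ h
    rfl

end Reindex

namespace StrandSystem

/-! ### Codes as families of multisets -/

section Fiber

variable {n : ℕ}

/-- The sizes of the strands with given ends. -/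
def fiber (T : Multiset (Fin (n + 1) × Fin (n + 1) × ℕ)) (a b : Fin (n + 1)) : Multiset ℕ :=
  (T.filter fun t => t.1 = a ∧ t.2.1 = b).map (·.2.2)

lemma card_fiber (T : Multiset (Fin (n + 1) × Fin (n + 1) × ℕ)) (a b : Fin (n + 1)) :
    (fiber T a b).card = codeMult T a b := by
  rw [fiber, Multiset.card_map, codeMult, Multiset.countP_eq_card_filter]

/-- The strands with given ends and sizes. -/
def bundle (a b : Fin (n + 1)) (M : Multiset ℕ) : Multiset (Fin (n + 1) × Fin (n + 1) × ℕ) :=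
  M.map fun s => (a, b, s)

lemma bundle_fiber (T : Multiset (Fin (n + 1) × Fin (n + 1) × ℕ))
    (p : Fin (n + 1) × Fin (n + 1)) :
    bundle p.1 p.2 (fiber T p.1 p.2) = T.filter fun t => (t.1, t.2.1) = p := by
  rw [bundle, fiber, Multiset.map_map]
  have : ∀ t ∈ T.filter (fun t => t.1 = p.1 ∧ t.2.1 = p.2),
      ((fun s => (p.1, p.2, s)) ∘ fun t : Fin (n + 1) × Fin (n + 1) × ℕ => t.2.2) t = id t := by
    intro t ht
    obtain ⟨-, h1, h2⟩ := Multiset.mem_filter.1 ht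
    exact Prod.ext h1.symm (Prod.ext h2.symm rfl)
  rw [Multiset.map_congr rfl this, Multiset.map_id]
  refine Multiset.filter_congr fun t _ => ?_
  rw [Prod.ext_iff]

lemma sum_bundle_fiber (T : Multiset (Fin (n + 1) × Fin (n + 1) × ℕ)) :
    ∑ p : Fin (n + 1) × Fin (n + 1), bundle p.1 p.2 (fiber T p.1 p.2) = T := by
  simp only [bundle_fiber]
  induction T using Multiset.induction with
  | empty => simp
  | cons t T ih =>
    simp only [Multiset.filter_cons, sum_add_distrib]
    rw [ih]
    simp [Multiset.singleton_add]

lemma card_eq_sum_codeMult (T : Multiset (Fin (n + 1) × Fin (n + 1) × ℕ)) :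
    T.card = ∑ a, ∑ b, codeMult T a b := by
  conv_lhs => rw [← sum_bundle_fiber T]
  rw [Multiset.card_sum, Fintype.sum_prod_type]
  simp [bundle, card_fiber]

variable {ι : Type*} [Fintype ι] (pr : ι → Fin (n + 1) × Fin (n + 1))

/-- The code with given families of strands at given pairs of ends. -/
def assemble (M : ι → Multiset ℕ) : Multiset (Fin (n + 1) × Fin (n + 1) × ℕ) :=
  ∑ k, bundle (pr k).1 (pr k).2 (M k)

lemma mem_assemble {M : ι → Multiset ℕ} {t : Fin (n + 1) × Fin (n + 1) × ℕ} :
    t ∈ assemble pr M ↔ ∃ k, t.1 = (pr k).1 ∧ t.2.1 = (pr k).2 ∧ t.2.2 ∈ M k := by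
  simp only [assemble, Multiset.mem_sum, mem_univ, true_and, bundle, Multiset.mem_map]
  refine exists_congr fun k => ⟨?_, ?_⟩
  · rintro ⟨s, hs, rfl⟩
    exact ⟨rfl, rfl, hs⟩
  · rintro ⟨h1, h2, h3⟩
    exact ⟨_, h3, Prod.ext h1.symm (Prod.ext h2.symm rfl)⟩

lemma fiber_add (T U : Multiset (Fin (n + 1) × Fin (n + 1) × ℕ)) (a b : Fin (n + 1)) :
    fiber (T + U) a b = fiber T a b + fiber U a b := by
  simp [fiber]

lemma fiber_bundle (a b c d : Fin (n + 1)) (M : Multiset ℕ) :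
    fiber (bundle a b M) c d = if (a, b) = (c, d) then M else 0 := by
  rw [fiber, bundle, Multiset.filter_map, Multiset.map_map]
  split_ifs with h
  · simp only [Prod.mk.injEq] at h
    simp [h]
  · simp only [Prod.mk.injEq] at h
    simp [h]

lemma fiber_assemble (M : ι → Multiset ℕ) (a b : Fin (n + 1)) :
    fiber (assemble pr M) a b = ∑ k, if pr k = (a, b) then M k else 0 := by
  have h : ∀ s : Finset ι, fiber (∑ k ∈ s, bundle (pr k).1 (pr k).2 (M k)) a b =
      ∑ k ∈ s, if pr k = (a, b) then M k else 0 := by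
    classical
    intro s
    induction s using Finset.induction_on with
    | empty => simp [fiber]
    | insert k s hk ih => rw [sum_insert hk, sum_insert hk, fiber_add, ih, fiber_bundle]
  exact h univ

lemma codeMult_assemble (M : ι → Multiset ℕ) (a b : Fin (n + 1)) :
    codeMult (assemble pr M) a b = ∑ k, if pr k = (a, b) then (M k).card else 0 := by
  rw [← card_fiber, fiber_assemble, Multiset.card_sum]
  refine sum_congr rfl fun k _ => ?_
  split_ifs <;> simp

lemma sum_assemble (M : ι → Multiset ℕ) :
    ((assemble pr M).map (·.2.2)).sum = ∑ k, (M k).sum := by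
  have h : ∀ s : Finset ι, ((∑ k ∈ s, bundle (pr k).1 (pr k).2 (M k)).map (·.2.2)).sum =
      ∑ k ∈ s, (M k).sum := by
    classical
    intro s
    induction s using Finset.induction_on with
    | empty => simp
    | insert k s hk ih =>
      rw [sum_insert hk, sum_insert hk, Multiset.map_add, Multiset.sum_add, ih]
      simp [bundle]
  exact h univ

lemma card_assemble (M : ι → Multiset ℕ) : (assemble pr M).card = ∑ k, (M k).card := by
  simp [assemble, bundle]

variable {pr}

lemma fiber_assemble_apply (hpr : Function.Injective pr) (M : ι → Multiset ℕ) (k : ι) :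
    fiber (assemble pr M) (pr k).1 (pr k).2 = M k := by
  classical
  rw [fiber_assemble]
  simp [hpr.eq_iff]

/-- Sorting the triples by their ends loses nothing when only the listed pairs of ends occur. -/
lemma assemble_fiber (hpr : Function.Injective pr) {T : Multiset (Fin (n + 1) × Fin (n + 1) × ℕ)}
    (hT : ∀ a b, (∀ k, pr k ≠ (a, b)) → codeMult T a b = 0) :
    assemble pr (fun k => fiber T (pr k).1 (pr k).2) = T := by
  classical
  conv_rhs => rw [← sum_bundle_fiber T]
  rw [assemble]
  rw [← sum_image (s := univ) (g := pr) (f := fun p => bundle p.1 p.2 (fiber T p.1 p.2))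
    (fun _ _ _ _ h => hpr h)]
  refine sum_subset (subset_univ _) fun p _ hp => ?_
  have h := hT p.1 p.2 fun k hk => hp (mem_image.2 ⟨k, mem_univ _, hk⟩)
  rw [← card_fiber, Multiset.card_eq_zero] at h
  simp [h, bundle]

end Fiber

end StrandSystem

namespace StrandSystem

/-! ### Blocks with five reducible elements, nullity three and basic block of height six -/

/-- The ends of the strands of a block: two pairs of strands that join consecutive nodes, a strand
that joins nonconsecutive nodes, and two optional strands between the other consecutive nodes. -/
def slot : Fin 9 → Fin 5 → Fin 5 × Fin 5 :=
  ![![(1, 2), (2, 3), (0, 4), (0, 1), (3, 4)],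
    ![(0, 1), (2, 3), (0, 4), (1, 2), (3, 4)],
    ![(0, 1), (2, 3), (1, 4), (1, 2), (3, 4)],
    ![(0, 1), (2, 3), (2, 4), (1, 2), (3, 4)],
    ![(0, 1), (3, 4), (0, 2), (1, 2), (2, 3)],
    ![(0, 1), (3, 4), (2, 4), (1, 2), (2, 3)],
    ![(1, 2), (3, 4), (0, 2), (0, 1), (2, 3)],
    ![(1, 2), (3, 4), (0, 3), (0, 1), (2, 3)],
    ![(1, 2), (3, 4), (0, 4), (0, 1), (2, 3)]]

lemma slot_injective (c : Fin 9) : Function.Injective (slot c) := by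
  revert c
  decide

lemma slot_lt (c : Fin 9) (k : Fin 5) : (slot c k).1 < (slot c k).2 := by
  revert c k
  decide

/-- The numbers of strands of a block. -/
def slotMult (c : Fin 9) (d e : ℕ) (a b : Fin 5) : ℕ :=
  ∑ k, if slot c k = (a, b) then (![2, 2, 1, d, e] : Fin 5 → ℕ) k else 0

lemma slotMult_red (c : Fin 9) (d e : Fin 2) (a : Fin 5) : ∃ b b' : Fin 5, (b' = a ∨ b = a) ∧
    (((b : ℕ) + 1 < b' ∧ 1 ≤ slotMult c d e b b') ∨ 2 ≤ slotMult c d e b b') := by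
  revert c d e a
  decide +kernel

lemma slotMult_nullity (c : Fin 9) (d e : Fin 2) :
    (2 + 2 + 1 + d + e : ℕ) + #{b : Fin 4 | slotMult c d e b.castSucc b.succ = 0} = 7 := by
  revert c d e
  decide +kernel

lemma slotMult_height (c : Fin 9) (d e : Fin 2) :
    4 + #{b : Fin 4 | 2 ≤ slotMult c d e b.castSucc b.succ} = 6 := by
  revert c d e
  decide +kernel

/-- The first two slots identify the doubled gaps. The third is the only pair of nonconsecutive
nodes in a shape, so merely occurring among the slots of `c'` identifies it. -/
lemma eq_of_slot_eq (c c' : Fin 9) (h0 : slot c 0 = slot c' 0 ∨ slot c 0 = slot c' 1)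
    (h1 : slot c 1 = slot c' 0 ∨ slot c 1 = slot c' 1) (h2 : ∃ k, slot c 2 = slot c' k) :
    c = c' := by
  revert c c'
  decide +kernel

/-- Unrolls reducibility of each node into inequalities that linear arithmetic can use. -/
lemma red_cases {m : Fin 5 → Fin 5 → ℕ} (hz : ∀ a b, ¬ a < b → m a b = 0)
    (hred : ∀ a, ∃ b c : Fin 5, (c = a ∨ b = a) ∧
      (((b : ℕ) + 1 < c ∧ 1 ≤ m b c) ∨ 2 ≤ m b c)) :
    (2 ≤ m 0 1 ∨ 1 ≤ m 0 2 ∨ 1 ≤ m 0 3 ∨ 1 ≤ m 0 4) ∧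
    (2 ≤ m 0 1 ∨ 2 ≤ m 1 2 ∨ 1 ≤ m 1 3 ∨ 1 ≤ m 1 4) ∧
    (2 ≤ m 1 2 ∨ 2 ≤ m 2 3 ∨ 1 ≤ m 0 2 ∨ 1 ≤ m 2 4) ∧
    (2 ≤ m 2 3 ∨ 2 ≤ m 3 4 ∨ 1 ≤ m 0 3 ∨ 1 ≤ m 1 3) ∧
    (2 ≤ m 3 4 ∨ 1 ≤ m 0 4 ∨ 1 ≤ m 1 4 ∨ 1 ≤ m 2 4) := by
  have r0 : 2 ≤ m 0 1 ∨ 1 ≤ m 0 2 ∨ 1 ≤ m 0 3 ∨ 1 ≤ m 0 4 := by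
    obtain ⟨b, c, rfl | rfl, h⟩ := hred 0
    · have := hz b 0 (by simp)
      omega
    · have := hz 0 0 (by simp)
      fin_cases c <;> simp at h this ⊢ <;> omega
  have r1 : 2 ≤ m 0 1 ∨ 2 ≤ m 1 2 ∨ 1 ≤ m 1 3 ∨ 1 ≤ m 1 4 := by
    obtain ⟨b, c, rfl | rfl, h⟩ := hred 1
    · have := hz b 1
      fin_cases b <;> simp at h this ⊢ <;> omega
    · have := hz 1 c
      fin_cases c <;> simp at h this ⊢ <;> omega
  have r2 : 2 ≤ m 1 2 ∨ 2 ≤ m 2 3 ∨ 1 ≤ m 0 2 ∨ 1 ≤ m 2 4 := by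
    obtain ⟨b, c, rfl | rfl, h⟩ := hred 2
    · have := hz b 2
      fin_cases b <;> simp at h this ⊢ <;> omega
    · have := hz 2 c
      fin_cases c <;> simp at h this ⊢ <;> omega
  have r3 : 2 ≤ m 2 3 ∨ 2 ≤ m 3 4 ∨ 1 ≤ m 0 3 ∨ 1 ≤ m 1 3 := by
    obtain ⟨b, c, rfl | rfl, h⟩ := hred 3
    · have := hz b 3
      fin_cases b <;> simp at h this ⊢ <;> omega
    · have := hz 3 c
      fin_cases c <;> simp at h this ⊢ <;> omega
  have r4 : 2 ≤ m 3 4 ∨ 1 ≤ m 0 4 ∨ 1 ≤ m 1 4 ∨ 1 ≤ m 2 4 := by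
    obtain ⟨b, c, rfl | rfl, h⟩ := hred 4
    · have := hz b 4
      fin_cases b <;> simp at h this ⊢ <;> omega
    · have := hz 4 c
      fin_cases c <;> simp at h this ⊢ <;> omega
  exact ⟨r0, r1, r2, r3, r4⟩

/-- The numbers of strands are those of a given shape. -/
def IsSlotMult (m : Fin 5 → Fin 5 → ℕ) (c : Fin 9) : Prop :=
  (∀ k, m (slot c k).1 (slot c k).2 = (![2, 2, 1, m (slot c 3).1 (slot c 3).2,
    m (slot c 4).1 (slot c 4).2] : Fin 5 → ℕ) k) ∧ m (slot c 3).1 (slot c 3).2 ≤ 1 ∧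
    m (slot c 4).1 (slot c 4).2 ≤ 1 ∧ ∀ a b, (∀ k, slot c k ≠ (a, b)) → m a b = 0

lemma forall_of_forall_lt {p : Fin 5 → Fin 5 → Prop} (h : p 0 1 ∧ p 0 2 ∧ p 0 3 ∧ p 0 4 ∧ p 1 2 ∧
    p 1 3 ∧ p 1 4 ∧ p 2 3 ∧ p 2 4 ∧ p 3 4) (a b : Fin 5) (hab : a < b) : p a b := by
  obtain ⟨h1, h2, h3, h4, h5, h6, h7, h8, h9, h10⟩ := h
  fin_cases a <;> fin_cases b <;> first | exact absurd hab (by decide) | assumption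

/-- The table `v` lists the largest multiplicities the shape allows; written out in numerals at each
use, it reduces the vanishing and the bounds to ten numerical inequalities. -/
lemma isSlotMult_of {m : Fin 5 → Fin 5 → ℕ} (hz : ∀ a b, ¬ a < b → m a b = 0) (c : Fin 9)
    {v : Fin 5 → Fin 5 → ℕ}
    (hv : ∀ a b, v a b = if slot c 0 = (a, b) ∨ slot c 1 = (a, b) then 2 else
      if ∃ k, slot c k = (a, b) then 1 else 0)
    (hm : ∀ a b, a < b → m a b ≤ v a b)
    (h0 : m (slot c 0).1 (slot c 0).2 = 2) (h1 : m (slot c 1).1 (slot c 1).2 = 2)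
    (h2 : m (slot c 2).1 (slot c 2).2 = 1) : IsSlotMult m c := by
  have hne : ∀ k, 3 ≤ k → ¬ (slot c 0 = slot c k ∨ slot c 1 = slot c k) := by
    intro k hk h
    rcases h with h | h <;> have := slot_injective c h <;> subst this <;> simp at hk
  have hle : ∀ k, 3 ≤ k → m (slot c k).1 (slot c k).2 ≤ 1 := by
    intro k hk
    refine (hm _ _ (slot_lt c k)).trans ?_
    rw [hv, if_neg (hne k hk), if_pos ⟨k, rfl⟩]
  refine ⟨fun k => ?_, hle 3 (by decide), hle 4 (by decide), fun a b hk => ?_⟩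
  · fin_cases k
    exacts [h0, h1, h2, rfl, rfl]
  · by_cases hab : a < b
    · have := hm a b hab
      rw [hv, if_neg (by simp [hk]), if_neg (by simpa using hk)] at this
      omega
    · exact hz a b hab

lemma exists_isSlotMult (m : Fin 5 → Fin 5 → ℕ) (hz : ∀ a b, ¬ a < b → m a b = 0)
    (hred : ∀ a, ∃ b c : Fin 5, (c = a ∨ b = a) ∧
      (((b : ℕ) + 1 < c ∧ 1 ≤ m b c) ∨ 2 ≤ m b c))
    (hnull : ∑ a, ∑ b, m a b + #{b : Fin 4 | m b.castSucc b.succ = 0} = 7)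
    (hheight : 4 + #{b : Fin 4 | 2 ≤ m b.castSucc b.succ} = 6) : ∃ c, IsSlotMult m c := by
  obtain ⟨r0, r1, r2, r3, r4⟩ := red_cases hz hred
  -- Every gap contributes at least one to the nullity count, whether empty or not. Only this bound
  -- on the indicators is needed, so they become opaque below.
  have hu : ∀ x : ℕ, 1 ≤ x + if x = 0 then 1 else 0 := by
    intro x
    split_ifs <;> omega
  have u0 := hu (m 0 1)
  have u1 := hu (m 1 2)
  have u2 := hu (m 2 3)
  have u3 := hu (m 3 4)
  rw [card_filter] at hnull hheight
  simp only [Fin.sum_univ_five] at hnull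
  rw [Fin.sum_univ_four] at hnull hheight
  change _ + ((if m 0 1 = 0 then 1 else 0) + (if m 1 2 = 0 then 1 else 0) +
    (if m 2 3 = 0 then 1 else 0) + (if m 3 4 = 0 then 1 else 0)) = 7 at hnull
  change 4 + ((if 2 ≤ m 0 1 then 1 else 0) + (if 2 ≤ m 1 2 then 1 else 0) +
    (if 2 ≤ m 2 3 then 1 else 0) + (if 2 ≤ m 3 4 then 1 else 0)) = 6 at hheight
  generalize (if m 0 1 = 0 then 1 else 0) = z0 at *
  generalize (if m 1 2 = 0 then 1 else 0) = z1 at *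
  generalize (if m 2 3 = 0 then 1 else 0) = z2 at *
  generalize (if m 3 4 = 0 then 1 else 0) = z3 at *
  by_cases d0 : 2 ≤ m 0 1 <;> by_cases d1 : 2 ≤ m 1 2 <;> by_cases d2 : 2 ≤ m 2 3 <;>
    by_cases d3 : 2 ≤ m 3 4 <;> simp only [d0, d1, d2, d3, if_true, if_false] at hheight <;>
    first | omega | skip
  · have e0 : m 0 1 = 2 := by omega
    have e1 : m 2 3 = 2 := by omega
    have h : m 0 4 = 1 ∨ m 1 4 = 1 ∨ m 2 4 = 1 := by omega
    rcases h with h | h | h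
    · exact ⟨1, isSlotMult_of hz 1
        (v := ![![0, 2, 0, 0, 1], ![0, 0, 1, 0, 0], ![0, 0, 0, 2, 0], ![0, 0, 0, 0, 1], ![0, 0, 0, 0, 0]]) (by decide)
        (forall_of_forall_lt (by simp; omega)) e0 e1 h⟩
    · exact ⟨2, isSlotMult_of hz 2
        (v := ![![0, 2, 0, 0, 0], ![0, 0, 1, 0, 1], ![0, 0, 0, 2, 0], ![0, 0, 0, 0, 1], ![0, 0, 0, 0, 0]]) (by decide)
        (forall_of_forall_lt (by simp; omega)) e0 e1 h⟩
    · exact ⟨3, isSlotMult_of hz 3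
        (v := ![![0, 2, 0, 0, 0], ![0, 0, 1, 0, 0], ![0, 0, 0, 2, 1], ![0, 0, 0, 0, 1], ![0, 0, 0, 0, 0]]) (by decide)
        (forall_of_forall_lt (by simp; omega)) e0 e1 h⟩
  · have e0 : m 0 1 = 2 := by omega
    have e1 : m 3 4 = 2 := by omega
    have h : m 0 2 = 1 ∨ m 2 4 = 1 := by omega
    rcases h with h | h
    · exact ⟨4, isSlotMult_of hz 4
        (v := ![![0, 2, 1, 0, 0], ![0, 0, 1, 0, 0], ![0, 0, 0, 1, 0], ![0, 0, 0, 0, 2], ![0, 0, 0, 0, 0]]) (by decide)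
        (forall_of_forall_lt (by simp; omega)) e0 e1 h⟩
    · exact ⟨5, isSlotMult_of hz 5
        (v := ![![0, 2, 0, 0, 0], ![0, 0, 1, 0, 0], ![0, 0, 0, 1, 1], ![0, 0, 0, 0, 2], ![0, 0, 0, 0, 0]]) (by decide)
        (forall_of_forall_lt (by simp; omega)) e0 e1 h⟩
  · have e0 : m 1 2 = 2 := by omega
    have e1 : m 2 3 = 2 := by omega
    have h : m 0 4 = 1 := by omega
    exact ⟨0, isSlotMult_of hz 0
        (v := ![![0, 1, 0, 0, 1], ![0, 0, 2, 0, 0], ![0, 0, 0, 2, 0], ![0, 0, 0, 0, 1], ![0, 0, 0, 0, 0]]) (by decide)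
        (forall_of_forall_lt (by simp; omega)) e0 e1 h⟩
  · have e0 : m 1 2 = 2 := by omega
    have e1 : m 3 4 = 2 := by omega
    have h : m 0 2 = 1 ∨ m 0 3 = 1 ∨ m 0 4 = 1 := by omega
    rcases h with h | h | h
    · exact ⟨6, isSlotMult_of hz 6
        (v := ![![0, 1, 1, 0, 0], ![0, 0, 2, 0, 0], ![0, 0, 0, 1, 0], ![0, 0, 0, 0, 2], ![0, 0, 0, 0, 0]]) (by decide)
        (forall_of_forall_lt (by simp; omega)) e0 e1 h⟩
    · exact ⟨7, isSlotMult_of hz 7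
        (v := ![![0, 1, 0, 1, 0], ![0, 0, 2, 0, 0], ![0, 0, 0, 1, 0], ![0, 0, 0, 0, 2], ![0, 0, 0, 0, 0]]) (by decide)
        (forall_of_forall_lt (by simp; omega)) e0 e1 h⟩
    · exact ⟨8, isSlotMult_of hz 8
        (v := ![![0, 1, 0, 0, 1], ![0, 0, 2, 0, 0], ![0, 0, 0, 1, 0], ![0, 0, 0, 0, 2], ![0, 0, 0, 0, 0]]) (by decide)
        (forall_of_forall_lt (by simp; omega)) e0 e1 h⟩

end StrandSystem

/-! ### Shapes and sizes determine the codes -/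

/-- The beads of a strand that may be missing: no element if `a = 0`, and otherwise `a`. -/
def beads (a : ℕ) : Multiset ℕ := if a = 0 then 0 else {a}

lemma sum_beads (a : ℕ) : (beads a).sum = a := by
  unfold beads
  split_ifs with h <;> simp [h]

lemma pos_of_mem_beads {a s : ℕ} (h : s ∈ beads a) : 0 < s := by
  unfold beads at h
  split_ifs at h with h'
  · simp at h
  · simp only [Multiset.mem_singleton] at h
    omega

lemma card_beads_lt (a : ℕ) : (beads a).card < 2 := by
  unfold beads
  split_ifs <;> simp

/-- Since strands carry at least one bead, the number 0 is free to stand for an absent strand. -/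
lemma beads_sum {M : Multiset ℕ} (hM : M.card ≤ 1) (h : ∀ s ∈ M, 0 < s) :
    beads M.sum = M := by
  rcases Nat.le_one_iff_eq_zero_or_eq_one.1 hM with h0 | h1
  · rw [Multiset.card_eq_zero] at h0
    simp [h0, beads]
  · obtain ⟨a, rfl⟩ := Multiset.card_eq_one.1 h1
    have := h a (by simp)
    simp [beads, this.ne']

/-- The sizes of the strands of a block on `j` elements: two pairs of beaded strands, a single
strand, and two optional strands. -/
structure IsSizes (j : ℕ) (x : Multiset ℕ × Multiset ℕ × ℕ × ℕ × ℕ) : Prop where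
  card_left : x.1.card = 2
  card_right : x.2.1.card = 2
  pos_left : ∀ s ∈ x.1, 0 < s
  pos_right : ∀ s ∈ x.2.1, 0 < s
  pos : 0 < x.2.2.1
  sum_eq : x.1.sum + x.2.1.sum + x.2.2.1 + x.2.2.2.1 + x.2.2.2.2 + 5 = j

/-- The sizes as a family. -/
def sizes (x : Multiset ℕ × Multiset ℕ × ℕ × ℕ × ℕ) : Fin 5 → Multiset ℕ :=
  ![x.1, x.2.1, {x.2.2.1}, beads x.2.2.2.1, beads x.2.2.2.2]

lemma sizes_injective : Function.Injective sizes := by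
  intro x y h
  have h0 : x.1 = y.1 := congrFun h 0
  have h1 : x.2.1 = y.2.1 := congrFun h 1
  have h2 : ({x.2.2.1} : Multiset ℕ) = {y.2.2.1} := congrFun h 2
  have h3 : beads x.2.2.2.1 = beads y.2.2.2.1 := congrFun h 3
  have h4 : beads x.2.2.2.2 = beads y.2.2.2.2 := congrFun h 4
  exact Prod.ext h0 (Prod.ext h1 (Prod.ext (Multiset.singleton_inj.1 h2)
    (Prod.ext (by rw [← sum_beads x.2.2.2.1, h3, sum_beads])
      (by rw [← sum_beads x.2.2.2.2, h4, sum_beads]))))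

namespace StrandSystem

lemma card_sizes {j : ℕ} {x : Multiset ℕ × Multiset ℕ × ℕ × ℕ × ℕ} (hx : IsSizes j x) (k : Fin 5) :
    (sizes x k).card = (![2, 2, 1, (beads x.2.2.2.1).card, (beads x.2.2.2.2).card] :
      Fin 5 → ℕ) k := by
  fin_cases k
  exacts [hx.card_left, hx.card_right, rfl, rfl, rfl]

lemma codeMult_assemble_slot {j : ℕ} {x : Multiset ℕ × Multiset ℕ × ℕ × ℕ × ℕ} (hx : IsSizes j x)
    (c : Fin 9) (a b : Fin 5) : codeMult (n := 4) (assemble (slot c) (sizes x)) a b =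
      slotMult c (beads x.2.2.2.1).card (beads x.2.2.2.2).card a b := by
  rw [codeMult_assemble, slotMult]
  simp only [card_sizes hx]

lemma isCode_assemble {j : ℕ} {x : Multiset ℕ × Multiset ℕ × ℕ × ℕ × ℕ} (hx : IsSizes j x)
    (c : Fin 9) : IsCode 4 j 3 6 (assemble (slot c) (sizes x)) := by
  -- An optional strand occurs zero or one time, so its multiplicity is an element of `Fin 2` and
  -- the facts decided by enumeration apply.
  have hred := slotMult_red c ⟨_, card_beads_lt x.2.2.2.1⟩ ⟨_, card_beads_lt x.2.2.2.2⟩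
  have hnull := slotMult_nullity c ⟨_, card_beads_lt x.2.2.2.1⟩ ⟨_, card_beads_lt x.2.2.2.2⟩
  have hheight := slotMult_height c ⟨_, card_beads_lt x.2.2.2.1⟩
    ⟨_, card_beads_lt x.2.2.2.2⟩
  refine ⟨?_, ?_, ?_, ?_, ?_⟩
  · intro t ht
    obtain ⟨k, h1, h2, h3⟩ := (mem_assemble _).1 ht
    refine ⟨by rw [h1, h2]; exact slot_lt c k, ?_⟩
    fin_cases k
    · exact hx.pos_left _ h3
    · exact hx.pos_right _ h3
    · obtain h3 := Multiset.mem_singleton.1 h3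
      rw [h3]
      exact hx.pos
    · exact pos_of_mem_beads h3
    · exact pos_of_mem_beads h3
  · rw [sum_assemble, Fin.sum_univ_five, ← hx.sum_eq]
    simp [sizes, sum_beads]
    ring
  · simpa only [codeMult_assemble_slot hx] using hred
  · rw [card_assemble, Fin.sum_univ_five]
    simp only [card_sizes hx, codeMult_assemble_slot hx]
    exact hnull
  · simpa only [codeMult_assemble_slot hx] using hheight

lemma exists_slot_eq_of_codeMult {j : ℕ} {x : Multiset ℕ × Multiset ℕ × ℕ × ℕ × ℕ}
    (hx : IsSizes j x) (c : Fin 9) {p : Fin 5 × Fin 5}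
    (h : 1 ≤ codeMult (n := 4) (assemble (slot c) (sizes x)) p.1 p.2) : ∃ k, p = slot c k := by
  by_contra! hne
  rw [codeMult_assemble_slot hx, slotMult, sum_eq_zero] at h
  · omega
  · intro k _
    exact if_neg (hne k).symm

lemma codeMult_slot {j : ℕ} {x : Multiset ℕ × Multiset ℕ × ℕ × ℕ × ℕ}
    (hx : IsSizes j x) (c : Fin 9) (k : Fin 5) :
    codeMult (n := 4) (assemble (slot c) (sizes x)) (slot c k).1 (slot c k).2 =
      (![2, 2, 1, (beads x.2.2.2.1).card, (beads x.2.2.2.2).card] : Fin 5 → ℕ) k := by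
  rw [← card_fiber, fiber_assemble_apply (slot_injective c), card_sizes hx]

lemma slot_eq_of_two_le {j : ℕ} {x : Multiset ℕ × Multiset ℕ × ℕ × ℕ × ℕ}
    (hx : IsSizes j x) (c : Fin 9) {p : Fin 5 × Fin 5}
    (h : 2 ≤ codeMult (n := 4) (assemble (slot c) (sizes x)) p.1 p.2) :
    p = slot c 0 ∨ p = slot c 1 := by
  obtain ⟨k, rfl⟩ := exists_slot_eq_of_codeMult hx c (one_le_two.trans h)
  rw [codeMult_slot hx] at h
  have h1 := card_beads_lt x.2.2.2.1
  have h2 := card_beads_lt x.2.2.2.2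
  fin_cases k
  · exact .inl rfl
  · exact .inr rfl
  · exact absurd h (by simp)
  · exact absurd h h1.not_ge
  · exact absurd h h2.not_ge

/-- The multiplicities determine a shape, and the fibres over its slots are the sizes; the three
slots with at most one strand are recorded by their sums. -/
lemma exists_isSizes {j : ℕ} {T : Multiset (Fin 5 × Fin 5 × ℕ)} (hT : IsCode 4 j 3 6 T) :
    ∃ c x, IsSizes j x ∧ assemble (n := 4) (slot c) (sizes x) = T := by
  have hz : ∀ a b : Fin 5, ¬ a < b → codeMult (n := 4) T a b = 0 := by
    intro a b hab
    rw [codeMult, Multiset.countP_eq_zero]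
    rintro t ht ⟨rfl, rfl⟩
    exact hab (hT.valid t ht).1
  obtain ⟨c, h1, h2, h3, h4⟩ := exists_isSlotMult (codeMult (n := 4) T) hz hT.red
    (by rw [← card_eq_sum_codeMult]; exact hT.nullity) hT.height
  have hpos : ∀ a b, ∀ s ∈ fiber (n := 4) T a b, 0 < s := by
    intro a b s hs
    rw [fiber, Multiset.mem_map] at hs
    obtain ⟨t, ht, rfl⟩ := hs
    exact (hT.valid t (Multiset.mem_filter.1 ht).1).2
  let F : Fin 5 → Multiset ℕ := fun k => fiber (n := 4) T (slot c k).1 (slot c k).2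
  have hF : ∀ k, (F k).card = codeMult (n := 4) T (slot c k).1 (slot c k).2 :=
    fun k => card_fiber _ _ _
  have hTF : assemble (slot c) F = T := assemble_fiber (slot_injective c) h4
  have hF2 : (F 2).card = 1 := (hF 2).trans (h1 2)
  obtain ⟨u, hu⟩ := Multiset.card_eq_one.1 hF2
  have hsF : sizes (F 0, F 1, (F 2).sum, (F 3).sum, (F 4).sum) = F := by
    funext k
    fin_cases k
    · rfl
    · rfl
    · change {(F 2).sum} = F 2
      rw [hu, Multiset.sum_singleton]
    · exact beads_sum ((hF 3).trans_le h2) (hpos _ _)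
    · exact beads_sum ((hF 4).trans_le h3) (hpos _ _)
  refine ⟨c, (F 0, F 1, (F 2).sum, (F 3).sum, (F 4).sum), ⟨(hF 0).trans (h1 0), (hF 1).trans (h1 1),
    hpos _ _, hpos _ _, ?_, ?_⟩, by rw [hsF, hTF]⟩
  · dsimp only
    rw [hu, Multiset.sum_singleton]
    exact hpos (slot c 2).1 (slot c 2).2 u (by change u ∈ F 2; simp [hu])
  · have := hT.size
    rw [← hTF, sum_assemble, Fin.sum_univ_five] at this
    dsimp only
    omega

/-- The codes of blocks are given by one of nine shapes and sizes of the strands. -/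
theorem card_isCode (j : ℕ) :
    Nat.card {T // IsCode 4 j 3 6 T} = 9 * Nat.card {x // IsSizes j x} := by
  have h : Nat.card (Fin 9 × {x // IsSizes j x}) = Nat.card {T // IsCode 4 j 3 6 T} := by
    refine Nat.card_eq_of_bijective
      (fun cx => ⟨assemble (slot cx.1) (sizes cx.2.1), isCode_assemble cx.2.2 cx.1⟩) ⟨?_, ?_⟩
    · rintro ⟨c, x, hx⟩ ⟨d, y, hy⟩ hcd
      have hcd : assemble (n := 4) (slot c) (sizes x) = assemble (slot d) (sizes y) :=
        congrArg Subtype.val hcd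
      have h := codeMult_slot hx c
      rw [hcd] at h
      obtain rfl : c = d := eq_of_slot_eq c d (slot_eq_of_two_le hy d (h 0).ge)
        (slot_eq_of_two_le hy d (h 1).ge) (exists_slot_eq_of_codeMult hy d (h 2).ge)
      have hs : sizes x = sizes y := by
        funext k
        rw [← fiber_assemble_apply (n := 4) (slot_injective c) (sizes x), hcd,
          fiber_assemble_apply (slot_injective c)]
      obtain rfl := sizes_injective hs
      rfl
    · rintro ⟨T, hT⟩
      obtain ⟨c, x, hx, rfl⟩ := exists_isSizes hT
      exact ⟨⟨c, x, hx⟩, rfl⟩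
  rw [← h, Nat.card_prod, Nat.card_fin]

end StrandSystem

/-! ### Counting the sizes -/

/-- The number of sizes in terms of partitions. -/
theorem card_isSizes (j : ℕ) : Nat.card {x // IsSizes j x} =
    ∑ w ∈ sizeSet j, partitionCount w.1 2 * partitionCount w.2.1 2 := by
  have h : Nat.card (Σ w : sizeSet j, {p : Nat.Partition w.1.1 // p.parts.card = 2} ×
      {p : Nat.Partition w.1.2.1 // p.parts.card = 2}) = Nat.card {x // IsSizes j x} := by
    refine Nat.card_eq_of_bijective (fun w => ⟨(w.2.1.1.parts, w.2.2.1.parts, w.1.1.2.2), ?_⟩)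
      ⟨?_, ?_⟩
    · obtain ⟨⟨w, hw⟩, ⟨p, hp⟩, ⟨q, hq⟩⟩ := w
      obtain ⟨h1, h2, h3, h4⟩ := mem_sizeSet.1 hw
      exact ⟨hp, hq, fun s hs => p.parts_pos hs, fun s hs => q.parts_pos hs, h3,
        by simpa only [p.parts_sum, q.parts_sum] using h4⟩
    · rintro ⟨⟨⟨a, b, w⟩, hw⟩, ⟨p, hp⟩, ⟨q, hq⟩⟩ ⟨⟨⟨a', b', w'⟩, hw'⟩, ⟨p', hp'⟩, ⟨q', hq'⟩⟩ h
      simp only [Subtype.mk.injEq, Prod.mk.injEq] at h p q p' q'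
      obtain ⟨h1, h2, rfl⟩ := h
      obtain rfl : a = a' := by rw [← p.parts_sum, h1, p'.parts_sum]
      obtain rfl : b = b' := by rw [← q.parts_sum, h2, q'.parts_sum]
      obtain rfl := Nat.Partition.ext h1
      obtain rfl := Nat.Partition.ext h2
      rfl
    · rintro ⟨⟨M, N, c, a, b⟩, hx⟩
      have two_le : ∀ M : Multiset ℕ, M.card = 2 → (∀ s ∈ M, 0 < s) → 2 ≤ M.sum := by
        intro M hM hs
        obtain ⟨s, t, rfl⟩ := Multiset.card_eq_two.1 hM
        have := hs s (by simp)
        have := hs t (by simp)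
        simp
        omega
      have hw : (M.sum, N.sum, c, a, b) ∈ sizeSet j :=
        mem_sizeSet.2 ⟨two_le M hx.card_left hx.pos_left, two_le N hx.card_right hx.pos_right,
          hx.pos, hx.sum_eq⟩
      exact ⟨⟨⟨_, hw⟩, ⟨⟨M, fun {s} => hx.pos_left s, rfl⟩, hx.card_left⟩,
        ⟨⟨N, fun {s} => hx.pos_right s, rfl⟩, hx.card_right⟩⟩, rfl⟩
  rw [← h, Nat.card_sigma, ← Finset.sum_coe_sort (sizeSet j)]
  exact sum_congr rfl fun w _ => Nat.card_prod _ _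

theorem mainTheorem5 (j : ℕ) (hj : 10 ≤ j) :
    Nat.card (BlockClass j 5 3 6) =
      (∑ u ∈ Icc 4 (j - 6), ∑ r ∈ Icc 0 (u - 4), ∑ l ∈ Icc 1 (j - u - 5),
          ∑ s ∈ Icc 1 (j - u - l - 4),
            4 * partitionCount (u - r - 2) 2 * partitionCount (j - u - l - s - 2) 2)
      + (∑ p ∈ Icc 7 (j - 3), ∑ q ∈ Icc 1 (p - 6), ∑ l ∈ Icc 2 (p - q - 4),
            2 * (l - 1) * partitionCount (p - q - l - 2) 2 * partitionCount (j - p - 1) 2)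
      + (∑ t ∈ Icc 1 (j - 9), ∑ k ∈ Icc 2 (j - t - 7), ∑ l ∈ Icc 4 (j - k - t - 3),
            (k - 1) * partitionCount (l - 2) 2 * partitionCount (j - k - t - l - 1) 2)
      + (∑ s ∈ Icc 1 (j - 9), ∑ t ∈ Icc 1 (j - s - 8), ∑ m ∈ Icc 0 (j - t - s - 8),
          ∑ p ∈ Icc 4 (j - t - s - m - 4),
            2 * partitionCount (p - 2) 2 * partitionCount (j - t - s - m - p - 2) 2) := by
  have h1 := sum_first (j := j) fun a b => partitionCount a 2 * partitionCount b 2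
  have h2 := sum_second (j := j) fun a b => partitionCount a 2 * partitionCount b 2
  have h3 := sum_third (j := j) fun a b => partitionCount a 2 * partitionCount b 2
  have h4 := sum_fourth (j := j) fun a b => partitionCount a 2 * partitionCount b 2
  -- With the constants pulled out, the right side is 4 + 2 + 1 + 2 copies of one sum, matching the
  -- nine shapes.
  simp only [mul_assoc, ← mul_sum] at h1 h2 h3 h4 ⊢
  rw [h1, h2, h3, h4, card_blockClass 4, StrandSystem.card_isCode, card_isSizes]
  ring
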